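/- Let $\mathbb K$ be $\mathbb R$ or $\mathbb C$. For Banach spaces $(E_i)_{i\in I}$ over $\mathbb K$ and $1\le p<\infty$ let $(\oplus_i E_i)_{\ell^p}$ be their direct $\ell^p$-sum; for $p=\infty$ the same notation denotes their direct $c_0$-sum, i.e. the space of families $(x_i)$ such that $\{i:\|x_i\|>\alpha\}$ is finite for every $\alpha>0$, with the supremum norm. For a Banach space $X$ let $\mathcal K(X)$ be the space of compact operators on $X$, let $\mathcal A(X)$ be the operator-norm closure of the bounded finite rank operators on $X$, and equip the quotient algebra $\mathcal K(X)/\mathcal A(X)$ with the quotient norm. Let $d_{BM}(E,F)=\inf\{\|T\|\,\|T^{-1}\|: T\colon E\to F \text{ a linear isomorphism}\}$ denote the Banach–Mazur distance. Theorem. There is an uncountable set $\Gamma$ such that the following holds. Let $(E_n)_{n\in\mathbb N}$ be any sequence of finite-dimensional normed spaces over $\mathbb K$ that is dense, with respect to $d_{BM}$, in the class of all (nonzero) finite-dimensional normed spaces, i.e. for every such $F$ and every $\delta>1$ there is $n$ with $d_{BM}(E_n,F)<\delta$; let $(G_m)_{m\in\mathbb N}$ be any listing of the spaces $E_n$ in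 which each $E_n$ is repeated infinitely often; and let $1\le p\le\infty$. Let $C_p=(\oplus_{m\in\mathbb N}G_m)_{\ell^p}$ be Johnson's space, and let $$Z=Z^p_{FJ}=\big(\oplus_W W\big)_{\ell^p},$$ where $W$ runs through all closed infinite-dimensional subspaces of $C_p$, be the Figiel–Johnson universal compact factorisation space. Then $c_0(\Gamma)$ is linearly isomorphic to a subspace of $\mathcal K(Z)/\mathcal A(Z)$: there are a bounded linear map $\Phi\colon c_0(\Gamma)\to\mathcal K(Z)/\mathcal A(Z)$ and a constant $c>0$ with $\|\Phi(a)\|\ge c\|a\|_\infty$ for all $a\in c_0(\Gamma)$. In particular, $\mathcal K(Z)/\mathcal A(Z)$ is non-separable. -/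

import Mathlib

open scoped ENNReal Topology

universe u v

section DirectSums

variable (𝕜 : Type*) [RCLike 𝕜] {ι : Type*} (E : ι → Type*)
  [∀ i, NormedAddCommGroup (E i)] [∀ i, NormedSpace 𝕜 (E i)]

/-- The direct `ℓ^p`-sum of the spaces `E i`, with the convention that for `p = ∞` it is the
`c₀`-sum: the bounded families whose norms tend to zero along the cofinite filter, with the
supremum norm. -/
def lpDirectSum (p : ℝ≥0∞) [Fact (1 ≤ p)] : Submodule 𝕜 (lp E p) where
  carrier := {x | p = ∞ → Filter.Tendsto (fun i => ‖x i‖) Filter.cofinite (𝓝 0)}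
  zero_mem' := fun _ => by
    simpa using (tendsto_const_nhds : Filter.Tendsto (fun _ : ι => (0 : ℝ)) Filter.cofinite (𝓝 0))
  add_mem' := by
    intro x y hx hy hp
    refine squeeze_zero (fun i => norm_nonneg _) (fun i => ?_)
      (by simpa using (hx hp).add (hy hp))
    exact norm_add_le (x i) (y i)
  smul_mem' := by
    intro c x hx hp
    have h := (hx hp).const_mul ‖c‖
    simpa [norm_smul] using h

/-- The space `c₀(Γ)` with the supremum norm. -/
abbrev cZero (Γ : Type*) : Submodule 𝕜 (lp (fun _ : Γ => 𝕜) ∞) :=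
  lpDirectSum 𝕜 (fun _ : Γ => 𝕜) ∞

end DirectSums

section Operators

variable (𝕜 : Type*) [RCLike 𝕜] (X Y : Type*) [NormedAddCommGroup X] [NormedSpace 𝕜 X]
  [NormedAddCommGroup Y] [NormedSpace 𝕜 Y]

/-- The bounded finite rank operators `X → Y`. -/
def finiteRankOperators : Submodule 𝕜 (X →L[𝕜] Y) where
  carrier := {T | FiniteDimensional 𝕜 (LinearMap.range (T : X →ₗ[𝕜] Y))}
  zero_mem' := by
    change FiniteDimensional 𝕜 (LinearMap.range ((0 : X →L[𝕜] Y) : X →ₗ[𝕜] Y))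
    rw [ContinuousLinearMap.toLinearMap_zero, LinearMap.range_zero]
    infer_instance
  add_mem' := by
    intro S T hS hT
    have hS' : FiniteDimensional 𝕜 (LinearMap.range (S : X →ₗ[𝕜] Y)) := hS
    have hT' : FiniteDimensional 𝕜 (LinearMap.range (T : X →ₗ[𝕜] Y)) := hT
    exact Submodule.finiteDimensional_of_le
      (LinearMap.range_add_le (S : X →ₗ[𝕜] Y) (T : X →ₗ[𝕜] Y))
  smul_mem' := by
    intro c T hT
    have hT' : FiniteDimensional 𝕜 (LinearMap.range (T : X →ₗ[𝕜] Y)) := hT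
    refine Submodule.finiteDimensional_of_le (S₂ := LinearMap.range (T : X →ₗ[𝕜] Y)) ?_
    rintro _ ⟨x, rfl⟩
    exact ⟨c • x, by simp⟩

/-- The approximable operators `X → Y`: the operator norm closure of the finite rank operators. -/
def approximableOperators : Submodule 𝕜 (X →L[𝕜] Y) :=
  (finiteRankOperators 𝕜 X Y).topologicalClosure

/-- The compact operators `X → Y`, with the operator norm. -/
abbrev compactOperators : Submodule 𝕜 (X →L[𝕜] Y) :=
  compactOperator (RingHom.id 𝕜) X Y

/-- For a Banach space `X`, the quotient `𝔄_X = K(X) / A(X)` of the compact operators by the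
approximable operators. -/
def CompactByApproximable : Type _ :=
  compactOperators 𝕜 X X ⧸
    (approximableOperators 𝕜 X X).submoduleOf (compactOperators 𝕜 X X)

instance isClosed_approximableOperators_submoduleOf :
    IsClosed ((approximableOperators 𝕜 X X).submoduleOf (compactOperators 𝕜 X X) :
      Set (compactOperators 𝕜 X X)) :=
  (finiteRankOperators 𝕜 X X).isClosed_topologicalClosure.preimage continuous_subtype_val

/-- The quotient norm `‖T + A(X)‖ = inf {‖T - S‖ : S ∈ A(X)}`. -/
noncomputable instance : NormedAddCommGroup (CompactByApproximable 𝕜 X) :=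
  inferInstanceAs (NormedAddCommGroup (compactOperators 𝕜 X X ⧸
    (approximableOperators 𝕜 X X).submoduleOf (compactOperators 𝕜 X X)))

noncomputable instance : NormedSpace 𝕜 (CompactByApproximable 𝕜 X) :=
  inferInstanceAs (NormedSpace 𝕜 (compactOperators 𝕜 X X ⧸
    (approximableOperators 𝕜 X X).submoduleOf (compactOperators 𝕜 X X)))

/-- Approximable operators into a Banach space are compact, so that `A(X)` really is a subspace
of `K(X)`. -/
theorem approximableOperators_le_compactOperators [CompleteSpace Y] :
    approximableOperators 𝕜 X Y ≤ compactOperators 𝕜 X Y := by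
  have h : IsClosed (compactOperators 𝕜 X Y : Set (X →L[𝕜] Y)) :=
    isClosed_setOfPred_isCompactOperator
  refine Submodule.topologicalClosure_minimal _ (fun T hT => ?_) h
  have hT' : FiniteDimensional 𝕜 (LinearMap.range (T : X →ₗ[𝕜] Y)) := hT
  have : ProperSpace (LinearMap.range (T : X →ₗ[𝕜] Y)) := FiniteDimensional.proper_rclike 𝕜 _
  let R : X →L[𝕜] LinearMap.range (T : X →ₗ[𝕜] Y) :=
    T.codRestrict (LinearMap.range (T : X →ₗ[𝕜] Y)) (fun x => ⟨x, rfl⟩)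
  have hR : IsCompactOperator R := isCompactOperator_of_locallyCompactSpace_dom R
  exact hR.clm_comp (LinearMap.range (T : X →ₗ[𝕜] Y)).subtypeL

/-- `X` embeds into `Y` as a linear isomorphic subspace: there is a bounded linear map `X → Y`
which is bounded below. -/
def IsomorphicallyEmbeds : Prop :=
  ∃ Φ : X →L[𝕜] Y, ∃ c : ℝ, 0 < c ∧ ∀ x : X, c * ‖x‖ ≤ ‖Φ x‖

end Operators

section UniversalSpaces

/-- The Banach–Mazur distance `inf ‖T‖ ‖T⁻¹‖` over all linear isomorphisms `T : E → F`
(it is `∞` if there are none). -/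
noncomputable def banachMazurDist (𝕜 : Type*) [RCLike 𝕜] (E F : Type*)
    [NormedAddCommGroup E] [NormedSpace 𝕜 E] [NormedAddCommGroup F] [NormedSpace 𝕜 F] : ℝ≥0∞ :=
  ⨅ T : E ≃L[𝕜] F,
    ENNReal.ofReal (‖(T : E →L[𝕜] F)‖ * ‖(T.symm : F →L[𝕜] E)‖)

/-- The sequence `E` is dense, for the Banach–Mazur distance, in the class of all (nonzero)
finite-dimensional normed spaces over `𝕜`. Every such space is isometric to one whose
underlying type is in the universe of `𝕜`. -/
def IsBanachMazurDense (𝕜 : Type u) [RCLike 𝕜] (E : ℕ → Type v)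
    [∀ n, NormedAddCommGroup (E n)] [∀ n, NormedSpace 𝕜 (E n)] : Prop :=
  ∀ (F : Type u) [NormedAddCommGroup F] [NormedSpace 𝕜 F] [FiniteDimensional 𝕜 F] [Nontrivial F],
    ∀ δ : ℝ≥0∞, 1 < δ → ∃ n, banachMazurDist 𝕜 (E n) F < δ

variable (𝕜 : Type*) [RCLike 𝕜] (E : ℕ → Type*)
  [∀ n, NormedAddCommGroup (E n)] [∀ n, NormedSpace 𝕜 (E n)]

/-- Johnson's space `C_p = (⊕ₘ Gₘ)_{ℓ^p}`, where `G m = E (s m)` is a listing of the spaces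
`E n`. -/
def JohnsonSpace (s : ℕ → ℕ) (p : ℝ≥0∞) [Fact (1 ≤ p)] : Type _ :=
  lpDirectSum 𝕜 (fun m => E (s m)) p

noncomputable instance (s : ℕ → ℕ) (p : ℝ≥0∞) [Fact (1 ≤ p)] :
    NormedAddCommGroup (JohnsonSpace 𝕜 E s p) :=
  inferInstanceAs (NormedAddCommGroup (lpDirectSum 𝕜 (fun m => E (s m)) p))

noncomputable instance (s : ℕ → ℕ) (p : ℝ≥0∞) [Fact (1 ≤ p)] :
    NormedSpace 𝕜 (JohnsonSpace 𝕜 E s p) :=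
  inferInstanceAs (NormedSpace 𝕜 (lpDirectSum 𝕜 (fun m => E (s m)) p))

/-- The closed infinite-dimensional subspaces of a normed space. -/
abbrev ClosedInfDimSubspace (X : Type*) [NormedAddCommGroup X] [NormedSpace 𝕜 X] : Type _ :=
  {W : Submodule 𝕜 X // IsClosed (W : Set X) ∧ ¬ FiniteDimensional 𝕜 W}

/-- The Figiel–Johnson universal compact factorisation space `Z^p_FJ`: the direct `ℓ^p`-sum of
all closed infinite-dimensional subspaces of `C_p`. -/
def FigielJohnsonSpace (s : ℕ → ℕ) (p : ℝ≥0∞) [Fact (1 ≤ p)] : Type _ :=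
  lpDirectSum 𝕜 (fun W : ClosedInfDimSubspace 𝕜 (JohnsonSpace 𝕜 E s p) => W.1) p

noncomputable instance (s : ℕ → ℕ) (p : ℝ≥0∞) [Fact (1 ≤ p)] :
    NormedAddCommGroup (FigielJohnsonSpace 𝕜 E s p) :=
  inferInstanceAs (NormedAddCommGroup
    (lpDirectSum 𝕜 (fun W : ClosedInfDimSubspace 𝕜 (JohnsonSpace 𝕜 E s p) => W.1) p))

noncomputable instance (s : ℕ → ℕ) (p : ℝ≥0∞) [Fact (1 ≤ p)] :
    NormedSpace 𝕜 (FigielJohnsonSpace 𝕜 E s p) :=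
  inferInstanceAs (NormedSpace 𝕜
    (lpDirectSum 𝕜 (fun W : ClosedInfDimSubspace 𝕜 (JohnsonSpace 𝕜 E s p) => W.1) p))

end UniversalSpaces

/-! The core is a variant of Davie's construction of a space without the approximation property.
Johnson's space contains, uniformly complemented and on disjoint coordinates, the sup-norm spaces of
functions on blocks of 4·2^n points. Basic vectors join the second sign system on block n to the
first one on block n+1. In the domain, block k carries the weight (5/4)^k; in the codomain the
weights are 1. Multiplication by (4/5)^k on block k is compact and carries each domain vector to its
codomain counterpart.

That this restricted operator is not approximable is seen by trace functionals: `trace n` averages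
the diagonal coefficients at level n, so it equals 1 on this operator. On the codomain a coefficient
can be read off either block of its vector (`coefB_eq_coefA`), so the difference of successive
traces is an average of evaluations at test vectors (`trace_succ_sub`). The random choice of signs
in `exists_signSystems` makes these vectors summably small; hence the traces are uniformly bounded.
They tend to zero on rank one operators, hence on all approximable ones, which excludes the value 1.

The space Z contains every closed infinite-dimensional subspace of Johnson's space only once, so one
bad pair must be turned into a continuum of bad pairs with distinct domains and distinct codomains.
Hyperplanes of the two spaces provide them (`exists_real_family_of_notMem_approximableOperators`),
each with an operator of norm at most 2 at distance at least 1 from the approximable ones. A null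
family of coefficients on these operators gives a compact operator on Z, and compression to one
entry recovers the size of each coefficient modulo the approximable operators. -/

/-! ### Random signs. -/

section SignChoices

/-- Hoeffding's inequality in counting form: there is a choice of signs for which finitely many
given linear forms with coefficients bounded by one are all small. -/
theorem exists_signs_abs_sum_le {J ι : Type*} [Fintype J] [Fintype ι] [Nonempty J]
    (a : ι → J → ℝ) (ha : ∀ i j, |a i j| ≤ 1) {t : ℝ} (ht : 0 < t)
    (hcard : 2 * (Fintype.card ι : ℝ) < Real.exp (t ^ 2 / (2 * Fintype.card J))) :
    ∃ ε : J → ℝ, (∀ j, ε j = 1 ∨ ε j = -1) ∧ ∀ i, |∑ j, ε j * a i j| ≤ t := by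
  classical
  set N : ℝ := (Fintype.card J : ℝ) with hN
  have hNpos : 0 < N := by rw [hN]; exact_mod_cast Fintype.card_pos
  -- This value minimises the Chernoff exponent `l ^ 2 * N / 2 - l * t`.
  set l : ℝ := t / N with hl
  have hlpos : 0 < l := div_pos ht hNpos
  let sg : Bool → ℝ := fun b => if b then 1 else -1
  let S : ι → (J → Bool) → ℝ := fun i e => ∑ j, sg (e j) * a i j
  -- The sum over all sign choices factorises into a product of hyperbolic cosines, each at most a
  -- Gaussian exponential.
  have key : ∀ (c : ℝ) (i : ι), |c| = l → ∑ e : J → Bool, Real.exp (c * S i e) ≤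
      2 ^ Fintype.card J * Real.exp (l ^ 2 / 2 * N) := by
    intro c i hc
    have h1 : ∀ e : J → Bool, Real.exp (c * S i e) = ∏ j, Real.exp (c * (sg (e j) * a i j)) := by
      intro e
      rw [← Real.exp_sum, Finset.mul_sum]
    simp_rw [h1]
    have h2 := (Finset.prod_univ_sum (fun _ : J => (Finset.univ : Finset Bool))
      (fun j b => Real.exp (c * (sg b * a i j)))).symm
    rw [Fintype.piFinset_univ] at h2
    rw [h2]
    have h3 : ∀ j, ∑ b : Bool, Real.exp (c * (sg b * a i j)) ≤ 2 * Real.exp (l ^ 2 / 2) := by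
      intro j
      have h4 : ∑ b : Bool, Real.exp (c * (sg b * a i j)) = 2 * Real.cosh (c * a i j) := by
        rw [Real.cosh_eq]; simp [sg]; ring
      rw [h4]
      have h5 : (c * a i j) ^ 2 ≤ l ^ 2 := by
        rw [← sq_abs, abs_mul, hc]
        exact pow_le_pow_left₀ (by positivity) (mul_le_of_le_one_right hlpos.le (ha i j)) 2
      have h6 : Real.exp ((c * a i j) ^ 2 / 2) ≤ Real.exp (l ^ 2 / 2) :=
        Real.exp_le_exp.2 (by linarith)
      linarith [Real.cosh_le_exp_half_sq (c * a i j)]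
    refine (Finset.prod_le_prod (fun j _ => by positivity) (fun j _ => h3 j)).trans ?_
    rw [Finset.prod_const, mul_pow, ← Real.exp_nat_mul, Finset.card_univ, ← hN, mul_comm N]
  have total : ∑ e : J → Bool, ∑ i, (Real.exp (l * S i e) + Real.exp (-l * S i e)) ≤
      ∑ e : J → Bool, 2 * Fintype.card ι * Real.exp (l ^ 2 / 2 * N) := by
    rw [Finset.sum_comm]
    simp_rw [Finset.sum_add_distrib]
    rw [← Finset.sum_add_distrib]
    calc _ ≤ ∑ _i : ι, (2 * (2 ^ Fintype.card J * Real.exp (l ^ 2 / 2 * N))) := by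
          refine Finset.sum_le_sum fun i _ => ?_
          have h1 := key l i (abs_of_pos hlpos)
          have h2 := key (-l) i (by rw [abs_neg, abs_of_pos hlpos])
          linarith
      _ = _ := by
          simp only [Finset.sum_const, Finset.card_univ, Fintype.card_fun, Fintype.card_bool,
            nsmul_eq_mul]
          push_cast
          ring
  obtain ⟨e, -, he⟩ := Finset.exists_le_of_sum_le Finset.univ_nonempty total
  refine ⟨fun j => sg (e j), fun j => by cases h : e j <;> simp [sg, h], fun i => ?_⟩
  change |S i e| ≤ t
  have hi : Real.exp (l * S i e) + Real.exp (-l * S i e) ≤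
      2 * Fintype.card ι * Real.exp (l ^ 2 / 2 * N) :=
    (Finset.single_le_sum (f := fun i => Real.exp (l * S i e) + Real.exp (-l * S i e))
      (fun i _ => by positivity) (Finset.mem_univ i)).trans he
  have hlt : 2 * Fintype.card ι * Real.exp (l ^ 2 / 2 * N) < Real.exp (l * t) := by
    have : l * t = t ^ 2 / (2 * N) + l ^ 2 / 2 * N := by rw [hl]; field_simp; ring
    rw [this, Real.exp_add]
    exact mul_lt_mul_of_pos_right hcard (Real.exp_pos _)
  rw [abs_le]
  constructor
  · have : Real.exp (-l * S i e) < Real.exp (l * t) := by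
      linarith [Real.exp_pos (l * S i e)]
    have := Real.exp_lt_exp.1 this
    nlinarith
  · have : Real.exp (l * S i e) < Real.exp (l * t) := by
      linarith [Real.exp_pos (-l * S i e)]
    have := Real.exp_lt_exp.1 this
    exact le_of_lt (lt_of_mul_lt_mul_left this hlpos.le)

end SignChoices

/-! ### Walsh functions. -/

section Walsh

/-- The Walsh functions, as a symmetric sign matrix. -/
def walsh {n : ℕ} (a j : Fin n → Bool) : ℝ := ∏ i, if a i && j i then -1 else 1

theorem walsh_sq {n : ℕ} (a j : Fin n → Bool) : walsh a j * walsh a j = 1 := by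
  rw [walsh, ← Finset.prod_mul_distrib]
  refine Finset.prod_eq_one fun i _ => ?_
  split_ifs <;> norm_num

theorem sum_walsh_mul_walsh {n : ℕ} (j j' : Fin n → Bool) :
    ∑ a, walsh a j * walsh a j' = if j = j' then 2 ^ n else 0 := by
  simp_rw [walsh, ← Finset.prod_mul_distrib]
  have h := (Finset.prod_univ_sum (fun _ : Fin n => (Finset.univ : Finset Bool))
    (fun i b => (if b && j i then (-1 : ℝ) else 1) * (if b && j' i then (-1 : ℝ) else 1))).symm
  rw [Fintype.piFinset_univ] at h
  rw [h]
  split_ifs with hj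
  · subst hj
    rw [Finset.prod_congr rfl (g := fun _ => (2 : ℝ))]
    · simp
    · intro i _
      cases j i <;> norm_num
  · obtain ⟨i, hi⟩ := Function.ne_iff.1 hj
    refine Finset.prod_eq_zero (Finset.mem_univ i) ?_
    cases h1 : j i <;> cases h2 : j' i <;> simp_all

end Walsh

/-! ### Flat sign systems on the blocks. -/

section SignSystems

/-- The finite sets on which the building blocks live. -/
abbrev BlockPoint (n : ℕ) : Type := (Bool × Bool) × (Fin n → Bool)

/-- The bound for the character sums at level `n`. -/
noncomputable def flatBound (n : ℕ) : ℝ := √(2 ^ (n + 1) * (2 * n + 6))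

theorem flatBound_pos (n : ℕ) : 0 < flatBound n := Real.sqrt_pos.2 (by positivity)

/-- A sign function all of whose correlations with polynomially many sign functions are small. -/
theorem exists_flat_signs {n : ℕ} {ι : Type*} [Fintype ι] (a : ι → (Fin n → Bool) → ℝ)
    (ha : ∀ i j, |a i j| ≤ 1) (hι : Fintype.card ι ≤ 2 ^ (2 * n + 5)) :
    ∃ ε : (Fin n → Bool) → ℝ, (∀ j, ε j = 1 ∨ ε j = -1) ∧
      ∀ i, |∑ j, ε j * a i j| ≤ flatBound n := by
  refine exists_signs_abs_sum_le a ha (flatBound_pos n) ?_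
  -- The bound is tuned so that the exponent is exactly 2n+6; since e > 2, this beats twice the
  -- 2^(2n+5) admissible constraints.
  have h1 : flatBound n ^ 2 / (2 * (Fintype.card (Fin n → Bool) : ℝ)) = ((2 * n + 6 : ℕ) : ℝ) := by
    rw [flatBound, Real.sq_sqrt (by positivity)]
    simp only [Fintype.card_fun, Fintype.card_bool, Fintype.card_fin]
    push_cast
    rw [pow_succ]
    field_simp
  rw [h1, ← mul_one ((2 * n + 6 : ℕ) : ℝ), Real.exp_nat_mul]
  have h2 : (2 : ℝ) < Real.exp 1 := by linarith [Real.exp_one_gt_d9]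
  calc 2 * (Fintype.card ι : ℝ) ≤ 2 * 2 ^ (2 * n + 5) := by
        have : (Fintype.card ι : ℝ) ≤ 2 ^ (2 * n + 5) := by exact_mod_cast hι
        linarith
    _ = 2 ^ (2 * n + 6) := by rw [pow_succ]; ring
    _ < _ := pow_lt_pow_left₀ h2 (by norm_num) (by omega)

theorem abs_eq_one_of_sign {x : ℝ} (h : x = 1 ∨ x = -1) : |x| = 1 := by
  rcases h with rfl | rfl <;> simp

theorem mul_self_of_sign {x : ℝ} (h : x = 1 ∨ x = -1) : x * x = 1 := by
  rcases h with rfl | rfl <;> simp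

theorem abs_walsh {n : ℕ} (a j : Fin n → Bool) : |walsh a j| = 1 :=
  abs_eq_one_of_sign (mul_self_eq_one_iff.1 (walsh_sq a j))

/-- Four sign functions whose pairwise products have flat Walsh correlations. -/
theorem exists_flat_family (n : ℕ) : ∃ f : Bool × Bool → (Fin n → Bool) → ℝ,
    (∀ b j, f b j = 1 ∨ f b j = -1) ∧
    ∀ b b', b ≠ b' → ∀ a a', |∑ j, f b j * f b' j * (walsh a j * walsh a' j)| ≤ flatBound n := by
  have hcard : ∀ k : ℕ, k ≤ 2 → Fintype.card (Fin k × (Fin n → Bool) × (Fin n → Bool)) ≤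
      2 ^ (2 * n + 5) := by
    intro k hk
    simp only [Fintype.card_prod, Fintype.card_fin, Fintype.card_fun, Fintype.card_bool]
    rw [pow_add, pow_mul', sq]
    nlinarith [Nat.zero_le (2 ^ n * 2 ^ n)]
  obtain ⟨x, hx, hxs⟩ := exists_flat_signs
    (fun (i : Fin 1 × (Fin n → Bool) × (Fin n → Bool)) j => walsh i.2.1 j * walsh i.2.2 j)
    (fun i j => by rw [abs_mul, abs_walsh, abs_walsh, one_mul]) (hcard 1 (by norm_num))
  obtain ⟨y, hy, hys⟩ := exists_flat_signs
    (fun (i : Fin 2 × (Fin n → Bool) × (Fin n → Bool)) j =>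
      (if i.1 = 0 then 1 else x j) * (walsh i.2.1 j * walsh i.2.2 j))
    (fun i j => by
      rw [abs_mul, abs_mul, abs_walsh, abs_walsh]
      split_ifs <;> simp [abs_eq_one_of_sign (hx j)]) (hcard 2 le_rfl)
  have h1 : ∀ a a', |∑ j, x j * (walsh a j * walsh a' j)| ≤ flatBound n :=
    fun a a' => hxs (0, a, a')
  have h2 : ∀ a a', |∑ j, y j * (walsh a j * walsh a' j)| ≤ flatBound n := fun a a' => by
    simpa using hys (0, a, a')
  have h3 : ∀ a a', |∑ j, x j * y j * (walsh a j * walsh a' j)| ≤ flatBound n := fun a a' => by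
    have := hys (1, a, a')
    simp only [one_ne_zero, if_false] at this
    simpa only [← mul_assoc, mul_comm (x _) (y _)] using this
  have hxx := fun j => mul_self_of_sign (hx j)
  have hyy := fun j => mul_self_of_sign (hy j)
  -- The four functions are 1, x, y and xy. They form a group of signs, so a product of two
  -- different ones is again x, y or xy, each of which is flat.
  refine ⟨fun b j => (if b.1 then x j else 1) * (if b.2 then y j else 1), ?_, ?_⟩
  · rintro ⟨b, c⟩ j
    rcases hx j with h | h <;> rcases hy j with h' | h' <;> cases b <;> cases c <;> simp [h, h']
  · have e1 : ∀ j, x j * (x j * y j) = y j := fun j => by rw [← mul_assoc, hxx, one_mul]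
    have e2 : ∀ j, x j * y j * x j = y j := fun j => by rw [mul_comm, e1]
    have e3 : ∀ j, y j * (x j * y j) = x j := fun j => by rw [mul_left_comm, hyy, mul_one]
    have e4 : ∀ j, x j * y j * y j = x j := fun j => by rw [mul_assoc, hyy, mul_one]
    have e5 : ∀ j, y j * x j = x j * y j := fun j => mul_comm _ _
    rintro ⟨b, c⟩ ⟨b', c'⟩ hb a a'
    cases b <;> cases c <;> cases b' <;> cases c' <;>
      first
      | exact absurd rfl hb
      | (simp only [if_true, if_false, one_mul, mul_one, e1, e2, e3, e4, e5, Bool.false_eq_true]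
         first | exact h1 _ _ | exact h2 _ _ | exact h3 _ _)

/-- Two systems of sign functions on each block, mutually orthogonal, with almost equal reproducing
kernels, such that the first system on one block and the second system on the preceding block are
almost uncorrelated. -/
theorem exists_signSystems : ∃ (σ : ∀ n, (Fin n → Bool) → BlockPoint n → ℝ)
    (τ : ∀ n, (Fin (n + 1) → Bool) → BlockPoint n → ℝ),
    (∀ n i j, ∑ g, σ n i g * σ n j g = if i = j then 2 ^ (n + 2) else 0) ∧
    (∀ n i j, ∑ g, τ n i g * τ n j g = if i = j then 2 ^ (n + 2) else 0) ∧
    (∀ n i j, ∑ g, σ n i g * τ n j g = 0) ∧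
    (∀ n g h, |(∑ j, τ n j g * τ n j h) / 2 ^ (n + 1) - (∑ j, σ n j g * σ n j h) / 2 ^ n| ≤
      2 * (flatBound n / 2 ^ n)) ∧
    (∀ n g h, |∑ j, σ (n + 1) j g * τ n j h| ≤ flatBound (n + 1)) := by
  choose f hf hflat using exists_flat_family
  -- Two distinct nontrivial characters of the four-element group: orthogonal to each other and to
  -- constants. This separates the two halves of `τ`, and separates `τ` from the first system.
  let r : Bool → Bool × Bool → ℝ := fun c b => if (if c then b.1 else b.2) then -1 else 1
  let τ : ∀ n, (Fin (n + 1) → Bool) → BlockPoint n → ℝ := fun n j g =>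
    r (j 0) g.1 * (f n g.1 (Fin.tail j) * walsh g.2 (Fin.tail j))
  let ρ : ∀ n, (Fin n → Bool) → BlockPoint n → ℝ := fun n j g => f n g.1 j * walsh g.2 j
  have habs : ∀ n b j, |f n b j| = 1 := fun n b j => abs_eq_one_of_sign (hf n b j)
  have hff : ∀ n b j, f n b j * f n b j = 1 := fun n b j => mul_self_of_sign (hf n b j)
  have hr : ∀ c b, |r c b| = 1 := by
    intro c b
    simp only [r]
    split_ifs <;> simp
  have hτ : ∀ n j g, |τ n j g| = 1 := fun n j g => by
    simp only [τ]
    rw [abs_mul, abs_mul, hr, habs, abs_walsh, one_mul, one_mul]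
  have hρ : ∀ n j g, |ρ n j g| = 1 := fun n j g => by
    simp only [ρ]
    rw [abs_mul, habs, abs_walsh, one_mul]
  -- A further sign for each function of the first system decorrelates it from the preceding block.
  -- Such signs square to 1, so orthogonality and kernels within a block are unaffected.
  have hε : ∀ n, ∃ ε : (Fin (n + 1) → Bool) → ℝ, (∀ j, ε j = 1 ∨ ε j = -1) ∧
      ∀ g h, |∑ j, ε j * (ρ (n + 1) j g * τ n j h)| ≤ flatBound (n + 1) := by
    intro n
    obtain ⟨ε, h1, h2⟩ := exists_flat_signs
      (fun (i : BlockPoint (n + 1) × BlockPoint n) j => ρ (n + 1) j i.1 * τ n j i.2)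
      (fun i j => by rw [abs_mul, hρ, hτ, one_mul]) (by
        simp only [Fintype.card_prod, Fintype.card_fin, Fintype.card_fun, Fintype.card_bool]
        have : 2 * 2 * 2 ^ (n + 1) * (2 * 2 * 2 ^ n) = 2 ^ (2 * n + 5) := by ring
        rw [this]
        exact Nat.pow_le_pow_right (by norm_num) (by omega))
    exact ⟨ε, h1, fun g h => h2 (g, h)⟩
  choose ε hε hεflat using hε
  -- Block 0 has no predecessor, so its sign is arbitrary.
  let η : ∀ n, (Fin n → Bool) → ℝ := fun n => match n with
    | 0 => fun _ => 1
    | n + 1 => ε n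
  have hη : ∀ n j, η n j = 1 ∨ η n j = -1 := by
    rintro (_ | n) j
    · exact Or.inl rfl
    · exact hε n j
  have hηη : ∀ n j, η n j * η n j = 1 := fun n j => mul_self_of_sign (hη n j)
  -- correlations over a block, with a factor depending on the first coordinate only
  have corr : ∀ n (i j : Fin n → Bool) (c : Bool × Bool → ℝ),
      ∑ g : BlockPoint n, c g.1 * (ρ n i g * ρ n j g) =
        if i = j then (∑ b, c b) * 2 ^ n else 0 := by
    intro n i j c
    rw [Fintype.sum_prod_type]
    have : ∀ b : Bool × Bool, ∑ a, c b * (ρ n i (b, a) * ρ n j (b, a)) =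
        c b * (f n b i * f n b j) * ∑ a, walsh a i * walsh a j := by
      intro b
      rw [Finset.mul_sum]
      exact Finset.sum_congr rfl fun a _ => by simp only [ρ]; ring
    simp only [this, sum_walsh_mul_walsh]
    split_ifs with h
    · subst h
      simp [hff, Finset.sum_mul]
    · simp
  refine ⟨fun n j g => η n j * ρ n j g, τ, ?_, ?_, ?_, ?_, ?_⟩
  · intro n i j
    have := corr n i j (fun _ => η n i * η n j)
    rw [show ∑ g, η n i * ρ n i g * (η n j * ρ n j g) =
      ∑ g : BlockPoint n, η n i * η n j * (ρ n i g * ρ n j g) from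
      Finset.sum_congr rfl fun g _ => by ring, this]
    split_ifs with h
    · subst h
      simp [hηη]
      ring
    · rfl
  · intro n i j
    have := corr n (Fin.tail i) (Fin.tail j) (fun b => r (i 0) b * r (j 0) b)
    rw [show ∑ g, τ n i g * τ n j g =
      ∑ g : BlockPoint n, r (i 0) g.1 * r (j 0) g.1 *
        (ρ n (Fin.tail i) g * ρ n (Fin.tail j) g) from
      Finset.sum_congr rfl fun g _ => by simp only [τ, ρ]; ring, this]
    have hij : i = j ↔ i 0 = j 0 ∧ Fin.tail i = Fin.tail j := by
      constructor
      · rintro rfl; exact ⟨rfl, rfl⟩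
      · rintro ⟨h, h'⟩
        rw [← Fin.cons_self_tail i, ← Fin.cons_self_tail j, h, h']
    by_cases h : Fin.tail i = Fin.tail j
    · simp only [hij, h, and_true, if_true]
      cases i 0 <;> cases j 0 <;> simp [r, Fintype.sum_prod_type] <;> ring
    · simp [hij, h]
  · intro n i j
    have := corr n i (Fin.tail j) (fun b => η n i * r (j 0) b)
    rw [show ∑ g, η n i * ρ n i g * τ n j g =
      ∑ g : BlockPoint n, η n i * r (j 0) g.1 * (ρ n i g * ρ n (Fin.tail j) g) from
      Finset.sum_congr rfl fun g _ => by simp only [τ, ρ]; ring, this]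
    split_ifs with h
    · cases j 0 <;> simp [r, Fintype.sum_prod_type]
    · rfl
  · rintro n ⟨b, a⟩ ⟨b', a'⟩
    set κ := ∑ j, f n b j * f n b' j * (walsh a j * walsh a' j) with hκ
    have hs : ∑ j, η n j * ρ n j (b, a) * (η n j * ρ n j (b', a')) = κ := by
      refine Finset.sum_congr rfl fun j _ => ?_
      have := hηη n j
      simp only [ρ]
      linear_combination (f n b j * f n b' j * (walsh a j * walsh a' j)) * this
    have ht : ∑ j, τ n j (b, a) * τ n j (b', a') = (∑ c, r c b * r c b') * κ := by
      rw [← (Fin.consEquiv (fun _ : Fin (n + 1) => Bool)).sum_comp, Fintype.sum_prod_type,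
        Finset.sum_mul]
      refine Finset.sum_congr rfl fun c _ => ?_
      rw [hκ, Finset.mul_sum]
      refine Finset.sum_congr rfl fun j _ => ?_
      have h0 : Fin.consEquiv (fun _ : Fin (n + 1) => Bool) (c, j) 0 = c := rfl
      have h1 : Fin.tail (Fin.consEquiv (fun _ : Fin (n + 1) => Bool) (c, j)) = j := rfl
      simp only [τ, h0, h1]
      ring
    rw [hs, ht]
    -- For equal first coordinates the normalised kernels coincide. Otherwise `κ` itself is flat,
    -- and it is multiplied by a factor of modulus at most 2.
    by_cases hb : b = b'
    · subst hb
      have : ∑ c, r c b * r c b = 2 := by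
        rw [Fintype.sum_bool]
        have := fun c => abs_mul_abs_self (r c b)
        rw [← this, ← this, hr, hr]; norm_num
      rw [this, pow_succ]
      have : 2 * κ / (2 ^ n * 2) - κ / 2 ^ n = 0 := by field_simp; ring
      rw [this, abs_zero]
      have := flatBound_pos n
      positivity
    · have h1 := hflat n b b' hb a a'
      rw [← hκ] at h1
      have h2 : |∑ c, r c b * r c b'| ≤ 2 := by
        rw [Fintype.sum_bool]
        refine (abs_add_le _ _).trans ?_
        rw [abs_mul, abs_mul, hr, hr, hr, hr]; norm_num
      have h3 : (∑ c, r c b * r c b') * κ / 2 ^ (n + 1) - κ / 2 ^ n =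
          ((∑ c, r c b * r c b') / 2 - 1) * (κ / 2 ^ n) := by
        rw [pow_succ]; field_simp
      rw [h3, abs_mul, abs_div κ, abs_of_pos (by positivity : (0 : ℝ) < 2 ^ n)]
      refine mul_le_mul ?_ ?_ (by positivity) (by norm_num)
      · rw [abs_le] at h2 ⊢
        constructor <;> linarith
      · gcongr
  · intro n g h
    have := hεflat n g h
    simpa only [η, mul_assoc] using this

end SignSystems

/-! ### Functionals that detect non-approximable operators. -/

section TraceObstruction

open Filter

/-- A uniform Lipschitz constant lets an approximation of the point absorb half of the tolerance.
The maps need not be linear, so that norms of coordinates are covered too. -/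
theorem isClosed_setOf_tendsto_zero_of_lipschitz {V F α : Type*} [SeminormedAddCommGroup V]
    [SeminormedAddCommGroup F] (f : Filter α) (l : α → V → F) (C : ℝ)
    (hC : ∀ n x y, ‖l n x - l n y‖ ≤ C * ‖x - y‖) :
    IsClosed {x | Tendsto (fun n => l n x) f (𝓝 0)} := by
  refine isClosed_of_closure_subset fun x hx => ?_
  rw [Set.mem_ofPred_eq, Metric.tendsto_nhds]
  intro ε hε
  obtain ⟨y, hy, hxy⟩ := Metric.mem_closure_iff.1 hx (ε / (2 * (|C| + 1))) (by positivity)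
  filter_upwards [Metric.tendsto_nhds.1 hy (ε / 2) (by positivity)] with n h1
  rw [dist_zero_right] at h1 ⊢
  have h2 : ‖l n x - l n y‖ ≤ ε / 2 := by
    refine (hC n x y).trans ?_
    rw [dist_eq_norm] at hxy
    have h3 : C * ‖x - y‖ ≤ (|C| + 1) * ‖x - y‖ :=
      mul_le_mul_of_nonneg_right (by linarith [le_abs_self C]) (norm_nonneg _)
    have h4 : (|C| + 1) * ‖x - y‖ ≤ (|C| + 1) * (ε / (2 * (|C| + 1))) :=
      mul_le_mul_of_nonneg_left hxy.le (by positivity)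
    have h5 : (|C| + 1) * (ε / (2 * (|C| + 1))) = ε / 2 := by field_simp
    linarith
  calc ‖l n x‖ = ‖(l n x - l n y) + l n y‖ := by rw [sub_add_cancel]
    _ ≤ ‖l n x - l n y‖ + ‖l n y‖ := norm_add_le _ _
    _ < ε := by linarith

variable {𝕜 : Type*} [RCLike 𝕜] {X Y : Type*} [NormedAddCommGroup X] [NormedSpace 𝕜 X]
  [NormedAddCommGroup Y] [NormedSpace 𝕜 Y]

/-- An operator of finite rank is a finite sum of operators of rank one. -/
theorem exists_eq_sum_smulRight {T : X →L[𝕜] Y} (hT : T ∈ finiteRankOperators 𝕜 X Y) :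
    ∃ (k : ℕ) (φ : Fin k → X →L[𝕜] 𝕜) (y : Fin k → Y), T = ∑ i, (φ i).smulRight (y i) := by
  have hfin : FiniteDimensional 𝕜 (LinearMap.range (T : X →ₗ[𝕜] Y)) := hT
  let R := LinearMap.range (T : X →ₗ[𝕜] Y)
  let b := Module.finBasis 𝕜 R
  let T' : X →L[𝕜] R := T.codRestrict R (fun x => ⟨x, rfl⟩)
  refine ⟨_, fun i => (LinearMap.toContinuousLinearMap (b.coord i)).comp T',
    fun i => (b i : Y), ?_⟩
  ext x
  have h := congrArg (Subtype.val) (b.sum_repr (T' x))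
  rw [Submodule.coe_sum] at h
  simp only [sum_apply]
  exact h.symm

/-- Bounded functionals on an operator space which tend to zero on the operators of rank one tend
to zero on all approximable operators. -/
theorem tendsto_zero_of_mem_approximableOperators (β : ℕ → (X →L[𝕜] Y) →L[𝕜] 𝕜) (C : ℝ)
    (hC : ∀ n T, ‖β n T‖ ≤ C * ‖T‖)
    (h : ∀ (φ : X →L[𝕜] 𝕜) (y : Y), Tendsto (fun n => β n (φ.smulRight y)) atTop (𝓝 0))
    {T : X →L[𝕜] Y} (hT : T ∈ approximableOperators 𝕜 X Y) :
    Tendsto (fun n => β n T) atTop (𝓝 0) := by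
  have hcl : IsClosed {S | Tendsto (fun n => β n S) atTop (𝓝 0)} :=
    isClosed_setOf_tendsto_zero_of_lipschitz atTop (fun n S => β n S) C fun n x y => by
      rw [← map_sub]; exact hC n _
  refine closure_minimal (fun S hS => ?_) hcl hT
  obtain ⟨k, φ, y, rfl⟩ := exists_eq_sum_smulRight hS
  simp only [Set.mem_ofPred_eq, map_sum]
  simpa using tendsto_finsetSum Finset.univ fun i _ => h (φ i) (y i)

end TraceObstruction

/-- The first system of sign functions. -/
noncomputable def signA : ∀ n, (Fin n → Bool) → BlockPoint n → ℝ := exists_signSystems.choose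

/-- The second system of sign functions. -/
noncomputable def signB : ∀ n, (Fin (n + 1) → Bool) → BlockPoint n → ℝ :=
  exists_signSystems.choose_spec.choose

theorem signSystems_spec :
    (∀ n i j, ∑ g, signA n i g * signA n j g = if i = j then 2 ^ (n + 2) else 0) ∧
    (∀ n i j, ∑ g, signB n i g * signB n j g = if i = j then 2 ^ (n + 2) else 0) ∧
    (∀ n i j, ∑ g, signA n i g * signB n j g = 0) ∧
    (∀ n g h, |(∑ j, signB n j g * signB n j h) / 2 ^ (n + 1) -
      (∑ j, signA n j g * signA n j h) / 2 ^ n| ≤ 2 * (flatBound n / 2 ^ n)) ∧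
    (∀ n g h, |∑ j, signA (n + 1) j g * signB n j h| ≤ flatBound (n + 1)) :=
  exists_signSystems.choose_spec.choose_spec

/-- Uniformly bounded coordinate inclusions and projections identifying the spaces of functions on
the blocks, with the supremum norm, with disjoint blocks of a normed space. -/
structure BlockSystem (𝕜 : Type*) [RCLike 𝕜] (Y : Type*) [NormedAddCommGroup Y]
    [NormedSpace 𝕜 Y] where
  /-- the inclusion of a block -/
  incl : ∀ n, (BlockPoint n → 𝕜) →L[𝕜] Y
  /-- the projection to a block -/
  proj : ∀ n, Y →L[𝕜] (BlockPoint n → 𝕜)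
  norm_incl_le : ∀ n, ‖incl n‖ ≤ 1
  norm_proj_le : ∀ n, ‖proj n‖ ≤ 2
  proj_incl : ∀ n f, proj n (incl n f) = f
  proj_incl_of_ne : ∀ m n, m ≠ n → ∀ f, proj m (incl n f) = 0

/-! ### The Davie-type subspaces and the partial traces. -/

namespace BlockSystem

open Filter

/-- The diagonal multipliers. -/
noncomputable def mult (𝕜 : Type*) [RCLike 𝕜] (n : ℕ) : 𝕜 := (((4 / 5 : ℝ) ^ n : ℝ) : 𝕜)

theorem mult_ne_zero (𝕜 : Type*) [RCLike 𝕜] (n : ℕ) : mult 𝕜 n ≠ 0 := by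
  rw [mult, Ne, RCLike.ofReal_eq_zero]; positivity

theorem norm_mult (𝕜 : Type*) [RCLike 𝕜] (n : ℕ) : ‖mult 𝕜 n‖ = (4 / 5) ^ n := by
  rw [mult, RCLike.norm_ofReal, abs_of_nonneg (by positivity)]

/-- The error bound for the successive differences of the traces. -/
noncomputable def err (n : ℕ) : ℝ := ((4 / 5 : ℝ) ^ n)⁻¹ * (flatBound n / 2 ^ n)

theorem err_nonneg (n : ℕ) : 0 ≤ err n := by
  have := flatBound_pos n
  rw [err]; positivity

/-- The error is of order n·(5/4·√2/2)^n, and 5√2/8 < 1. The multiplier 4/5 thus lies between 1/√2,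
needed here, and 1, needed for compactness of the diagonal operator. -/
theorem summable_err : Summable err := by
  set r : ℝ := 5 / 8 * √2 with hr
  have hr0 : 0 ≤ r := by positivity
  have hr1 : r < 1 := by
    have : √2 < 8 / 5 := by
      rw [Real.sqrt_lt' (by norm_num)]; norm_num
    rw [hr]; linarith
  have hnorm : ‖r‖ < 1 := by rwa [Real.norm_eq_abs, abs_of_nonneg hr0]
  have hs : Summable fun n : ℕ => 2 * ((n : ℝ) ^ 1 * r ^ n) + 6 * r ^ n :=
    ((summable_pow_mul_geometric_of_norm_lt_one 1 hnorm).mul_left 2).add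
      ((summable_geometric_of_lt_one hr0 hr1).mul_left 6)
  refine Summable.of_nonneg_of_le err_nonneg (fun n => ?_) hs
  have h1 : flatBound n ≤ √2 ^ n * (2 * n + 6) := by
    rw [flatBound, Real.sqrt_le_left (by positivity), mul_pow, ← pow_mul, mul_comm n, pow_mul,
      Real.sq_sqrt (by norm_num)]
    have : (0 : ℝ) ≤ 2 ^ n := by positivity
    have hn : (0 : ℝ) ≤ n := Nat.cast_nonneg n
    rw [pow_succ, mul_assoc]
    exact mul_le_mul_of_nonneg_left (by nlinarith) this
  calc err n ≤ ((4 / 5 : ℝ) ^ n)⁻¹ * ((√2 ^ n * (2 * n + 6)) / 2 ^ n) := by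
        rw [err]; gcongr
    _ = 2 * ((n : ℝ) ^ 1 * r ^ n) + 6 * r ^ n := by
        have : r ^ n = ((4 / 5 : ℝ) ^ n)⁻¹ * √2 ^ n / 2 ^ n := by
          rw [hr, ← inv_pow, ← mul_pow, ← div_pow]; congr 1; ring
        rw [this]; ring

variable {𝕜 : Type*} [RCLike 𝕜] {Y : Type*} [NormedAddCommGroup Y] [NormedSpace 𝕜 Y]
  (B : BlockSystem 𝕜 Y)

/-- The first system of sign functions, with values in `𝕜`. -/
noncomputable def fnA (𝕜 : Type*) [RCLike 𝕜] (n : ℕ) (j : Fin n → Bool) : BlockPoint n → 𝕜 :=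
  fun g => ((signA n j g : ℝ) : 𝕜)

/-- The second system of sign functions, with values in `𝕜`. -/
noncomputable def fnB (𝕜 : Type*) [RCLike 𝕜] (n : ℕ) (j : Fin (n + 1) → Bool) :
    BlockPoint n → 𝕜 :=
  fun g => ((signB n j g : ℝ) : 𝕜)

/-- The basic vectors, each supported by two consecutive blocks. -/
noncomputable def vec (c : ℕ → 𝕜) (n : ℕ) (j : Fin (n + 1) → Bool) : Y :=
  c n • B.incl n (fnB 𝕜 n j) + c (n + 1) • B.incl (n + 1) (fnA 𝕜 (n + 1) j)

/-- The linear span of the basic vectors. -/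
noncomputable def vecSpan (c : ℕ → 𝕜) : Submodule 𝕜 Y :=
  Submodule.span 𝕜 (Set.range fun i : Σ n, (Fin (n + 1) → Bool) => B.vec c i.1 i.2)

/-- The closed linear span of the basic vectors. -/
noncomputable def space (c : ℕ → 𝕜) : Submodule 𝕜 Y := (B.vecSpan c).topologicalClosure

theorem isClosed_space (c : ℕ → 𝕜) : IsClosed (B.space c : Set Y) :=
  Submodule.isClosed_topologicalClosure _

theorem vec_mem_vecSpan (c : ℕ → 𝕜) (n : ℕ) (j : Fin (n + 1) → Bool) :
    B.vec c n j ∈ B.vecSpan c :=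
  Submodule.subset_span ⟨⟨n, j⟩, rfl⟩

theorem vec_mem_space (c : ℕ → 𝕜) (n : ℕ) (j : Fin (n + 1) → Bool) :
    B.vec c n j ∈ B.space c :=
  Submodule.le_topologicalClosure _ (B.vec_mem_vecSpan c n j)

/-- The mean of a function on a block against a weight. -/
noncomputable def mean {n : ℕ} (w : BlockPoint n → 𝕜) : (BlockPoint n → 𝕜) →L[𝕜] 𝕜 :=
  ((2 : 𝕜) ^ (n + 2))⁻¹ • ∑ g, w g • ContinuousLinearMap.proj g

theorem mean_apply {n : ℕ} (w f : BlockPoint n → 𝕜) :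
    mean w f = ((2 : 𝕜) ^ (n + 2))⁻¹ * ∑ g, w g * f g := by
  simp [mean]

theorem mean_fnA_fnA (n : ℕ) (i j) : mean (fnA 𝕜 n i) (fnA 𝕜 n j) = if i = j then 1 else 0 := by
  have h := congrArg (fun x : ℝ => (x : 𝕜)) (signSystems_spec.1 n i j)
  rw [mean_apply]
  simp only [fnA]
  push_cast at h
  rw [h]
  split_ifs <;> push_cast <;> simp

theorem mean_fnB_fnB (n : ℕ) (i j) : mean (fnB 𝕜 n i) (fnB 𝕜 n j) = if i = j then 1 else 0 := by
  have h := congrArg (fun x : ℝ => (x : 𝕜)) (signSystems_spec.2.1 n i j)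
  rw [mean_apply]
  simp only [fnB]
  push_cast at h
  rw [h]
  split_ifs <;> push_cast <;> simp

theorem mean_fnA_fnB (n : ℕ) (i j) : mean (fnA 𝕜 n i) (fnB 𝕜 n j) = 0 := by
  have h := congrArg (fun x : ℝ => (x : 𝕜)) (signSystems_spec.2.2.1 n i j)
  rw [mean_apply]
  simp only [fnA, fnB]
  push_cast at h
  rw [h, mul_zero]

theorem mean_fnB_fnA (n : ℕ) (i j) : mean (fnB 𝕜 n i) (fnA 𝕜 n j) = 0 := by
  have h := mean_fnA_fnB (𝕜 := 𝕜) n j i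
  rw [mean_apply] at h ⊢
  simpa only [mul_comm] using h

/-- The coefficient functional of a basic vector, read off the first of its blocks. -/
noncomputable def coefB (n : ℕ) (j : Fin (n + 1) → Bool) : Y →L[𝕜] 𝕜 :=
  (mean (fnB 𝕜 n j)).comp (B.proj n)

/-- The coefficient functional of a basic vector, read off the second of its blocks. -/
noncomputable def coefA (n : ℕ) (j : Fin n → Bool) : Y →L[𝕜] 𝕜 :=
  (mean (fnA 𝕜 n j)).comp (B.proj n)

theorem proj_vec (c : ℕ → 𝕜) (n : ℕ) (j) : B.proj n (B.vec c n j) = c n • fnB 𝕜 n j := by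
  rw [vec, map_add, map_smul, map_smul, B.proj_incl, B.proj_incl_of_ne _ _ (by omega), smul_zero,
    add_zero]

theorem proj_succ_vec (c : ℕ → 𝕜) (n : ℕ) (j) :
    B.proj (n + 1) (B.vec c n j) = c (n + 1) • fnA 𝕜 (n + 1) j := by
  rw [vec, map_add, map_smul, map_smul, B.proj_incl, B.proj_incl_of_ne _ _ (by omega), smul_zero,
    zero_add]

theorem proj_vec_of_ne (c : ℕ → 𝕜) {m n : ℕ} (h : m ≠ n) (h' : m ≠ n + 1) (j) :
    B.proj m (B.vec c n j) = 0 := by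
  rw [vec, map_add, map_smul, map_smul, B.proj_incl_of_ne _ _ h, B.proj_incl_of_ne _ _ h',
    smul_zero, smul_zero, add_zero]

/-- With weights 1, a basic vector has the same coefficient on both of its blocks, and orthogonality
of the systems removes the neighbours that share a block. The identity passes to the closed span by
continuity. -/
theorem coefB_eq_coefA {x : Y} (hx : x ∈ B.space 1) (n : ℕ) (j : Fin (n + 1) → Bool) :
    B.coefB n j x = B.coefA (n + 1) j x := by
  have hcl : IsClosed ((LinearMap.ker (B.coefB n j - B.coefA (n + 1) j).toLinearMap :
      Submodule 𝕜 Y) : Set Y) := (B.coefB n j - B.coefA (n + 1) j).isClosed_ker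
  have hle : B.space 1 ≤ LinearMap.ker (B.coefB n j - B.coefA (n + 1) j).toLinearMap := by
    refine Submodule.topologicalClosure_minimal _ (Submodule.span_le.2 ?_) hcl
    rintro _ ⟨⟨m, i⟩, rfl⟩
    change B.coefB n j (B.vec 1 m i) - B.coefA (n + 1) j (B.vec 1 m i) = 0
    simp only [coefB, coefA, ContinuousLinearMap.comp_apply]
    rcases eq_or_ne n m with rfl | h1
    · rw [B.proj_vec, B.proj_succ_vec, map_smul, map_smul, mean_fnA_fnA, mean_fnB_fnB]
      simp
    · have h4 : mean (fnB 𝕜 n j) (B.proj n (B.vec 1 m i)) = 0 := by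
        rcases eq_or_ne n (m + 1) with rfl | h2
        · rw [B.proj_succ_vec, map_smul, mean_fnB_fnA, smul_zero]
        · rw [B.proj_vec_of_ne _ h1 h2, map_zero]
      have h5 : mean (fnA 𝕜 (n + 1) j) (B.proj (n + 1) (B.vec 1 m i)) = 0 := by
        rcases eq_or_ne (n + 1) m with rfl | h2
        · rw [B.proj_vec, map_smul, mean_fnA_fnB, smul_zero]
        · rw [B.proj_vec_of_ne _ h2 (by omega), map_zero]
      rw [h4, h5, sub_zero]
  have := hle hx
  rw [LinearMap.mem_ker] at this
  exact sub_eq_zero.1 this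

/-- The inverse multipliers. -/
noncomputable def invMult (𝕜 : Type*) [RCLike 𝕜] : ℕ → 𝕜 := fun n => (mult 𝕜 n)⁻¹

/-- A basic vector of the domain. -/
noncomputable def domVec (n : ℕ) (j : Fin (n + 1) → Bool) : B.space (invMult 𝕜) :=
  ⟨B.vec (invMult 𝕜) n j, B.vec_mem_space _ n j⟩

/-- The normalised partial traces. -/
noncomputable def trace (n : ℕ) : (B.space (invMult 𝕜) →L[𝕜] B.space (1 : ℕ → 𝕜)) →L[𝕜] 𝕜 :=
  ((2 : 𝕜) ^ (n + 1))⁻¹ • ∑ j, ((B.coefB n j).comp (B.space 1).subtypeL).comp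
    (ContinuousLinearMap.apply 𝕜 (B.space (1 : ℕ → 𝕜)) (B.domVec n j))

theorem trace_apply (n : ℕ) (S : B.space (invMult 𝕜) →L[𝕜] B.space (1 : ℕ → 𝕜)) :
    B.trace n S = ((2 : 𝕜) ^ (n + 1))⁻¹ * ∑ j, B.coefB n j (S (B.domVec n j)) := by
  simp [trace]

/-- The test vectors which represent the differences of successive traces. -/
noncomputable def testVec (n : ℕ) (g : BlockPoint (n + 1)) : B.space (invMult 𝕜) :=
  ((2 : 𝕜) ^ (n + 2))⁻¹ • ∑ j, fnB 𝕜 (n + 1) j g • B.domVec (n + 1) j -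
    ((2 : 𝕜) ^ (n + 1))⁻¹ • ∑ j, fnA 𝕜 (n + 1) j g • B.domVec n j

/-- Both traces are read off the common block n+1: the old one by `coefA`, the new one by `coefB`.
Expanding the means and exchanging sums leaves an average over the 2^(n+3) points of that block. -/
theorem trace_succ_sub (n : ℕ) (S : B.space (invMult 𝕜) →L[𝕜] B.space (1 : ℕ → 𝕜)) :
    B.trace (n + 1) S - B.trace n S =
      ((2 : 𝕜) ^ (n + 3))⁻¹ * ∑ g, B.proj (n + 1) (S (B.testVec n g)) g := by
  rw [trace_apply, trace_apply]
  simp_rw [fun j => B.coefB_eq_coefA (S (B.domVec n j)).2 n j]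
  simp only [coefB, coefA, ContinuousLinearMap.comp_apply, mean_apply, testVec, map_sub, map_smul,
    map_sum, Submodule.coe_sub, Submodule.coe_smul, Submodule.coe_sum, Pi.sub_apply, Pi.smul_apply,
    Finset.sum_apply, smul_eq_mul, Finset.sum_sub_distrib, mul_sub]
  congr 1
  · rw [← Finset.mul_sum, ← Finset.mul_sum, Finset.sum_comm]
    ring
  · rw [← Finset.mul_sum, ← Finset.mul_sum, Finset.sum_comm]
    ring

/-- Separates the three blocks met by a test vector. The outer coefficients are correlations between
consecutive blocks; the middle one is the difference of the two normalised reproducing kernels on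
block n+1. -/
theorem coe_testVec (n : ℕ) (g : BlockPoint (n + 1)) :
    (B.testVec n g : Y) =
      invMult 𝕜 (n + 2) • B.incl (n + 2)
        (fun h => ((2 : 𝕜) ^ (n + 2))⁻¹ * ∑ j, fnB 𝕜 (n + 1) j g * fnA 𝕜 (n + 2) j h) +
      invMult 𝕜 (n + 1) • B.incl (n + 1)
        (fun h => ((2 : 𝕜) ^ (n + 2))⁻¹ * ∑ j, fnB 𝕜 (n + 1) j g * fnB 𝕜 (n + 1) j h -
          ((2 : 𝕜) ^ (n + 1))⁻¹ * ∑ j, fnA 𝕜 (n + 1) j g * fnA 𝕜 (n + 1) j h) -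
      invMult 𝕜 n • B.incl n
        (fun h => ((2 : 𝕜) ^ (n + 1))⁻¹ * ∑ j, fnA 𝕜 (n + 1) j g * fnB 𝕜 n j h) := by
  have e : ∀ {m k : ℕ} (c : 𝕜) (w : (Fin k → Bool) → 𝕜)
      (f : (Fin k → Bool) → BlockPoint m → 𝕜),
      B.incl m (fun h => c * ∑ j, w j * f j h) = c • ∑ j, w j • B.incl m (f j) := by
    intro m k c w f
    rw [show (fun h => c * ∑ j, w j * f j h) = c • ∑ j, w j • f j by ext h; simp]
    simp only [map_smul, map_sum]
  have e' : ∀ {m : ℕ} (f f' : BlockPoint m → 𝕜), B.incl m (fun h => f h - f' h) =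
      B.incl m f - B.incl m f' := fun f f' => map_sub _ f f'
  rw [e', e, e, e, e]
  simp only [testVec, domVec, vec, Submodule.coe_sub, Submodule.coe_smul, Submodule.coe_sum,
    smul_add, Finset.sum_add_distrib, smul_sub, Finset.smul_sum, smul_comm (invMult 𝕜 _)]
  abel

theorem norm_invMult_smul_incl_le {n : ℕ} {f : BlockPoint n → 𝕜} {C : ℝ} (hC : 0 ≤ C)
    (hf : ∀ h, ‖f h‖ ≤ C) : ‖invMult 𝕜 n • B.incl n f‖ ≤ ((4 / 5 : ℝ) ^ n)⁻¹ * C := by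
  rw [norm_smul, invMult, norm_inv, norm_mult]
  refine mul_le_mul_of_nonneg_left ?_ (by positivity)
  refine (B.incl n).le_of_opNorm_le_of_le (B.norm_incl_le n) ((pi_norm_le_iff_of_nonneg hC).2 hf)
    |>.trans ?_
  rw [one_mul]

theorem norm_testVec_le (n : ℕ) (g : BlockPoint (n + 1)) :
    ‖B.testVec n g‖ ≤ err (n + 2) + 3 * err (n + 1) := by
  obtain ⟨-, -, -, hker, hcor⟩ := signSystems_spec
  have hpos := fun k => (flatBound_pos k).le
  have h2 : ∀ h, ‖((2 : 𝕜) ^ (n + 2))⁻¹ * ∑ j, fnB 𝕜 (n + 1) j g * fnA 𝕜 (n + 2) j h‖ ≤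
      flatBound (n + 2) / 2 ^ (n + 2) := by
    intro h
    rw [show ((2 : 𝕜) ^ (n + 2))⁻¹ * ∑ j, fnB 𝕜 (n + 1) j g * fnA 𝕜 (n + 2) j h =
      (((∑ j, signA (n + 2) j h * signB (n + 1) j g) / 2 ^ (n + 2) : ℝ) : 𝕜) by
        simp only [fnA, fnB]; push_cast; rw [div_eq_inv_mul]; simp only [mul_comm],
      RCLike.norm_ofReal, abs_div, abs_of_pos (by positivity : (0 : ℝ) < 2 ^ (n + 2))]
    gcongr
    exact hcor (n + 1) h g
  have h1 : ∀ h, ‖((2 : 𝕜) ^ (n + 2))⁻¹ * ∑ j, fnB 𝕜 (n + 1) j g * fnB 𝕜 (n + 1) j h -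
      ((2 : 𝕜) ^ (n + 1))⁻¹ * ∑ j, fnA 𝕜 (n + 1) j g * fnA 𝕜 (n + 1) j h‖ ≤
      2 * (flatBound (n + 1) / 2 ^ (n + 1)) := by
    intro h
    rw [show ((2 : 𝕜) ^ (n + 2))⁻¹ * ∑ j, fnB 𝕜 (n + 1) j g * fnB 𝕜 (n + 1) j h -
      ((2 : 𝕜) ^ (n + 1))⁻¹ * ∑ j, fnA 𝕜 (n + 1) j g * fnA 𝕜 (n + 1) j h =
      (((∑ j, signB (n + 1) j g * signB (n + 1) j h) / 2 ^ (n + 2) -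
        (∑ j, signA (n + 1) j g * signA (n + 1) j h) / 2 ^ (n + 1) : ℝ) : 𝕜) by
        simp only [fnA, fnB]; push_cast; rw [div_eq_inv_mul, div_eq_inv_mul],
      RCLike.norm_ofReal]
    exact hker (n + 1) g h
  have h0 : ∀ h, ‖((2 : 𝕜) ^ (n + 1))⁻¹ * ∑ j, fnA 𝕜 (n + 1) j g * fnB 𝕜 n j h‖ ≤
      flatBound (n + 1) / 2 ^ (n + 1) := by
    intro h
    rw [show ((2 : 𝕜) ^ (n + 1))⁻¹ * ∑ j, fnA 𝕜 (n + 1) j g * fnB 𝕜 n j h =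
      (((∑ j, signA (n + 1) j g * signB n j h) / 2 ^ (n + 1) : ℝ) : 𝕜) by
        simp only [fnA, fnB]; push_cast; rw [div_eq_inv_mul],
      RCLike.norm_ofReal, abs_div, abs_of_pos (by positivity : (0 : ℝ) < 2 ^ (n + 1))]
    gcongr
    exact hcor n g h
  have n2 := B.norm_invMult_smul_incl_le (by have := hpos (n + 2); positivity) h2
  have n1 := B.norm_invMult_smul_incl_le (by have := hpos (n + 1); positivity) h1
  have n0 := B.norm_invMult_smul_incl_le (by have := hpos (n + 1); positivity) h0
  -- Block n carries the smaller weight but the flatness bound of level n+1; enlarging the weight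
  -- gives the third copy of `err (n + 1)`.
  have hmono : ((4 / 5 : ℝ) ^ n)⁻¹ ≤ ((4 / 5 : ℝ) ^ (n + 1))⁻¹ :=
    inv_anti₀ (by positivity) (pow_le_pow_of_le_one (by norm_num) (by norm_num) (Nat.le_succ n))
  have hmono' := mul_le_mul_of_nonneg_right hmono
    (by have := hpos (n + 1); positivity : 0 ≤ flatBound (n + 1) / 2 ^ (n + 1))
  change ‖(B.testVec n g : Y)‖ ≤ _
  rw [coe_testVec]
  refine (norm_sub_le _ _).trans ?_
  refine (add_le_add_left (norm_add_le _ _) _).trans ?_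
  rw [err, err]
  linarith

theorem norm_trace_succ_sub_le (n : ℕ) (S : B.space (invMult 𝕜) →L[𝕜] B.space (1 : ℕ → 𝕜)) :
    ‖B.trace (n + 1) S - B.trace n S‖ ≤ 2 * (err (n + 2) + 3 * err (n + 1)) * ‖S‖ := by
  rw [trace_succ_sub, norm_mul, norm_inv, norm_pow, RCLike.norm_ofNat]
  have h : ∀ g ∈ (Finset.univ : Finset (BlockPoint (n + 1))),
      ‖B.proj (n + 1) (S (B.testVec n g)) g‖ ≤ 2 * (err (n + 2) + 3 * err (n + 1)) * ‖S‖ := by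
    intro g _
    have h1 := norm_le_pi_norm (B.proj (n + 1) (S (B.testVec n g))) g
    have h2 := (B.proj (n + 1)).le_of_opNorm_le (B.norm_proj_le (n + 1)) (S (B.testVec n g) : Y)
    have h3 : ‖(S (B.testVec n g) : Y)‖ ≤ ‖S‖ * (err (n + 2) + 3 * err (n + 1)) :=
      S.le_opNorm_of_le (B.norm_testVec_le n g)
    linarith
  have h' := (norm_sum_le _ _).trans (Finset.sum_le_card_nsmul _ _ _ h)
  have hc : (Finset.univ : Finset (BlockPoint (n + 1))).card = 2 ^ (n + 3) := by
    simp only [Finset.card_univ, Fintype.card_prod, Fintype.card_fun, Fintype.card_bool,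
      Fintype.card_fin]
    ring
  rw [hc, nsmul_eq_mul] at h'
  push_cast at h'
  rw [inv_mul_le_iff₀ (by positivity)]
  exact h'

/-- The differences of successive traces are summable in norm, so telescoping from `trace 0` gives a
uniform bound. -/
theorem exists_norm_trace_le : ∃ C : ℝ, ∀ n S, ‖B.trace n S‖ ≤ C * ‖S‖ := by
  set κ : ℕ → ℝ := fun n => 2 * (err (n + 2) + 3 * err (n + 1)) with hκ
  have hκ0 : ∀ n, 0 ≤ κ n := fun n => by
    have := err_nonneg (n + 2)
    have := err_nonneg (n + 1)
    simp only [hκ]; positivity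
  have hs : Summable κ := (((summable_nat_add_iff 2).2 summable_err).add
    (((summable_nat_add_iff 1).2 summable_err).mul_left 3)).mul_left 2
  refine ⟨‖B.trace 0‖ + ∑' n, κ n, fun n S => ?_⟩
  have h : ‖B.trace n S‖ ≤ (‖B.trace 0‖ + ∑ k ∈ Finset.range n, κ k) * ‖S‖ := by
    induction n with
    | zero => simpa using (B.trace 0).le_opNorm S
    | succ n ih =>
      have h1 := B.norm_trace_succ_sub_le n S
      have h2 := norm_le_norm_add_norm_sub' (B.trace (n + 1) S) (B.trace n S)
      rw [Finset.sum_range_succ]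
      have : κ n * ‖S‖ = 2 * (err (n + 2) + 3 * err (n + 1)) * ‖S‖ := rfl
      linarith
  refine h.trans (mul_le_mul_of_nonneg_right ?_ (norm_nonneg S))
  linarith [hs.sum_le_tsum (Finset.range n) fun i _ => hκ0 i]

/-- If y is a finite combination of basic vectors, its coefficients vanish at all high levels, so
the traces are eventually zero. Density and the uniform bound give the general case. -/
theorem tendsto_trace_smulRight (φ : B.space (invMult 𝕜) →L[𝕜] 𝕜) (y : B.space (1 : ℕ → 𝕜)) :
    Tendsto (fun n => B.trace n (φ.smulRight y)) atTop (𝓝 0) := by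
  obtain ⟨C, hC⟩ := B.exists_norm_trace_le
  have hC0 : ∀ n S, ‖B.trace n S‖ ≤ |C| * ‖S‖ := fun n S =>
    (hC n S).trans (mul_le_mul_of_nonneg_right (le_abs_self C) (norm_nonneg _))
  have hcl := isClosed_setOf_tendsto_zero_of_lipschitz atTop
    (fun n (y : B.space (1 : ℕ → 𝕜)) => B.trace n (φ.smulRight y)) (|C| * ‖φ‖) (by
      intro n x y
      have : φ.smulRight x - φ.smulRight y = φ.smulRight (x - y) := by
        ext z; simp [smul_sub]
      rw [← map_sub, this, mul_assoc]
      refine (hC0 n _).trans (le_of_eq ?_)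
      rw [ContinuousLinearMap.norm_smulRight_apply])
  have hspan : ∀ x ∈ B.vecSpan (1 : ℕ → 𝕜), ∀ᶠ n in atTop, ∀ j, B.coefB n j x = 0 := by
    intro x hx
    induction hx using Submodule.span_induction with
    | mem x hx =>
      obtain ⟨⟨m, i⟩, rfl⟩ := hx
      filter_upwards [eventually_gt_atTop (m + 1)] with n hn j
      rw [coefB, ContinuousLinearMap.comp_apply, B.proj_vec_of_ne _ (by omega) (by omega), map_zero]
    | zero => exact Eventually.of_forall fun n j => map_zero _
    | add x y _ _ hx hy =>
      filter_upwards [hx, hy] with n h1 h2 j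
      rw [map_add, h1, h2, add_zero]
    | smul c x _ hx =>
      filter_upwards [hx] with n h1 j
      rw [map_smul, h1, smul_zero]
  have hy : y ∈ closure {z : B.space (1 : ℕ → 𝕜) | (z : Y) ∈ B.vecSpan (1 : ℕ → 𝕜)} := by
    rw [closure_subtype]
    have : ((↑) '' {z : B.space (1 : ℕ → 𝕜) | (z : Y) ∈ B.vecSpan (1 : ℕ → 𝕜)} : Set Y) =
        B.vecSpan (1 : ℕ → 𝕜) := by
      ext z
      constructor
      · rintro ⟨z, hz, rfl⟩; exact hz
      · intro hz; exact ⟨⟨z, Submodule.le_topologicalClosure _ hz⟩, hz, rfl⟩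
    rw [this]
    exact y.2
  refine closure_minimal (fun z hz => ?_) hcl hy
  refine (tendsto_congr' ?_).2 tendsto_const_nhds
  filter_upwards [hspan z hz] with n hn
  rw [trace_apply]
  simp [hn]

/-! ### The compact diagonal operator and its traces. -/

variable [CompleteSpace Y]

/-- The diagonal operator with the multipliers `mult`. -/
noncomputable def diagonal : Y →L[𝕜] Y := ∑' n, mult 𝕜 n • (B.incl n).comp (B.proj n)

theorem summable_diagonal : Summable fun n => mult 𝕜 n • (B.incl n).comp (B.proj n) := by
  refine Summable.of_norm_bounded (g := fun n => (4 / 5 : ℝ) ^ n * 2)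
    ((summable_geometric_of_lt_one (by norm_num) (by norm_num)).mul_right 2) fun n => ?_
  rw [norm_smul, norm_mult]
  refine mul_le_mul_of_nonneg_left ?_ (by positivity)
  refine (ContinuousLinearMap.opNorm_comp_le _ _).trans ?_
  have := mul_le_mul (B.norm_incl_le n) (B.norm_proj_le n) (norm_nonneg _) zero_le_one
  linarith

theorem diagonal_incl (n : ℕ) (f : BlockPoint n → 𝕜) :
    B.diagonal (B.incl n f) = mult 𝕜 n • B.incl n f := by
  have h := (ContinuousLinearMap.apply 𝕜 Y (B.incl n f)).hasSum B.summable_diagonal.hasSum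
  have h' := hasSum_single (f := fun m => (ContinuousLinearMap.apply 𝕜 Y (B.incl n f))
    (mult 𝕜 m • (B.incl m).comp (B.proj m))) n (fun m hm => by
      simp [B.proj_incl_of_ne m n hm])
  have := h.unique h'
  simpa [diagonal, B.proj_incl] using this

theorem diagonal_vec (n : ℕ) (j) : B.diagonal (B.vec (invMult 𝕜) n j) = B.vec 1 n j := by
  simp [vec, diagonal_incl, invMult, smul_smul, mult_ne_zero]

theorem isCompactOperator_diagonal : IsCompactOperator B.diagonal := by
  have hcl : IsClosed (compactOperators 𝕜 Y Y : Set (Y →L[𝕜] Y)) :=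
    isClosed_setOfPred_isCompactOperator
  have hmem : ∀ n, mult 𝕜 n • (B.incl n).comp (B.proj n) ∈ compactOperators 𝕜 Y Y := by
    intro n
    refine Submodule.smul_mem _ _ ?_
    have : IsCompactOperator (B.proj n) := isCompactOperator_of_locallyCompactSpace_dom _
    exact this.clm_comp (B.incl n)
  exact hcl.mem_of_tendsto B.summable_diagonal.hasSum
    (Eventually.of_forall fun s => Submodule.sum_mem _ fun n _ => hmem n)

theorem diagonal_mem_space {x : Y} (hx : x ∈ B.space (invMult 𝕜)) : B.diagonal x ∈ B.space 1 := by
  have : B.space (invMult 𝕜) ≤ (B.space 1).comap B.diagonal.toLinearMap := by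
    refine Submodule.topologicalClosure_minimal _ (Submodule.span_le.2 ?_)
      ((B.isClosed_space 1).preimage B.diagonal.continuous)
    rintro _ ⟨⟨n, j⟩, rfl⟩
    change B.diagonal (B.vec _ n j) ∈ B.space 1
    rw [diagonal_vec]
    exact B.vec_mem_space 1 n j
  exact this hx

/-- The diagonal operator between the closed spans of the basic vectors. -/
noncomputable def diagonalRestrict : B.space (invMult 𝕜) →L[𝕜] B.space (1 : ℕ → 𝕜) :=
  (B.diagonal.comp (B.space (invMult 𝕜)).subtypeL).codRestrict _ fun x => B.diagonal_mem_space x.2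

theorem isCompactOperator_diagonalRestrict : IsCompactOperator B.diagonalRestrict :=
  (B.isCompactOperator_diagonal.comp_clm (B.space (invMult 𝕜)).subtypeL).codRestrict _
    (B.isClosed_space 1)

theorem trace_diagonalRestrict (n : ℕ) : B.trace n B.diagonalRestrict = 1 := by
  have h : ∀ j, B.coefB n j (B.diagonalRestrict (B.domVec n j)) = 1 := by
    intro j
    change B.coefB n j (B.diagonal (B.vec _ n j)) = 1
    rw [diagonal_vec, coefB, ContinuousLinearMap.comp_apply, proj_vec, map_smul, mean_fnB_fnB]
    simp
  rw [trace_apply]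
  simp [h]

theorem diagonalRestrict_notMem_approximableOperators :
    B.diagonalRestrict ∉ approximableOperators 𝕜 (B.space (invMult 𝕜)) (B.space (1 : ℕ → 𝕜)) := by
  intro h
  obtain ⟨C, hC⟩ := B.exists_norm_trace_le
  have := tendsto_zero_of_mem_approximableOperators B.trace C hC B.tendsto_trace_smulRight h
  simp only [trace_diagonalRestrict] at this
  exact one_ne_zero (tendsto_nhds_unique tendsto_const_nhds this)

end BlockSystem

/-! ### Ideal properties and normalisation modulo approximable operators. -/

section NonApproximable

variable {𝕜 : Type*} [RCLike 𝕜] {X Y Z : Type*} [NormedAddCommGroup X] [NormedSpace 𝕜 X]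
  [NormedAddCommGroup Y] [NormedSpace 𝕜 Y] [NormedAddCommGroup Z] [NormedSpace 𝕜 Z]

theorem clm_comp_mem_approximableOperators (R : Y →L[𝕜] Z) {S : X →L[𝕜] Y}
    (hS : S ∈ approximableOperators 𝕜 X Y) : R.comp S ∈ approximableOperators 𝕜 X Z := by
  refine map_mem_closure (f := fun S : X →L[𝕜] Y => R.comp S)
    (ContinuousLinearMap.compL 𝕜 X Y Z R).continuous hS fun S hS => ?_
  have hS' : FiniteDimensional 𝕜 (LinearMap.range (S : X →ₗ[𝕜] Y)) := hS
  change FiniteDimensional 𝕜 (LinearMap.range ((R : Y →ₗ[𝕜] Z) ∘ₗ (S : X →ₗ[𝕜] Y)))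
  rw [LinearMap.range_comp]
  infer_instance

theorem comp_clm_mem_approximableOperators {S : Y →L[𝕜] Z}
    (hS : S ∈ approximableOperators 𝕜 Y Z) (R : X →L[𝕜] Y) :
    S.comp R ∈ approximableOperators 𝕜 X Z := by
  refine map_mem_closure (f := fun S : Y →L[𝕜] Z => S.comp R)
    ((ContinuousLinearMap.compL 𝕜 X Y Z).flip R).continuous hS fun S hS => ?_
  have hS' : FiniteDimensional 𝕜 (LinearMap.range (S : Y →ₗ[𝕜] Z)) := hS
  change FiniteDimensional 𝕜 (LinearMap.range ((S : Y →ₗ[𝕜] Z) ∘ₗ (R : X →ₗ[𝕜] Y)))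
  exact Submodule.finiteDimensional_of_le (LinearMap.range_comp_le_range _ _)

theorem smulRight_mem_approximableOperators (φ : X →L[𝕜] 𝕜) (y : Y) :
    φ.smulRight y ∈ approximableOperators 𝕜 X Y := by
  refine Submodule.le_topologicalClosure _ ?_
  change FiniteDimensional 𝕜 (LinearMap.range (φ.smulRight y : X →ₗ[𝕜] Y))
  refine Submodule.finiteDimensional_of_le (S₂ := Submodule.span 𝕜 {y}) ?_
  rintro _ ⟨x, rfl⟩
  exact Submodule.smul_mem _ _ (Submodule.mem_span_singleton_self y)

theorem mem_approximableOperators_of_finiteDimensional_dom [FiniteDimensional 𝕜 X]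
    (T : X →L[𝕜] Y) : T ∈ approximableOperators 𝕜 X Y := by
  refine Submodule.le_topologicalClosure _ ?_
  change FiniteDimensional 𝕜 (LinearMap.range (T : X →ₗ[𝕜] Y))
  infer_instance

theorem mem_approximableOperators_of_finiteDimensional_cod [FiniteDimensional 𝕜 Y]
    (T : X →L[𝕜] Y) : T ∈ approximableOperators 𝕜 X Y := by
  refine Submodule.le_topologicalClosure _ ?_
  change FiniteDimensional 𝕜 (LinearMap.range (T : X →ₗ[𝕜] Y))
  infer_instance

/-- A compact operator which is not approximable can be modified so that it has norm at most two
and distance at least one from the approximable operators. -/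
theorem exists_normalized_of_notMem_approximableOperators [CompleteSpace Y] {T : X →L[𝕜] Y}
    (hc : IsCompactOperator T) (hT : T ∉ approximableOperators 𝕜 X Y) :
    ∃ T' : X →L[𝕜] Y, IsCompactOperator T' ∧ ‖T'‖ ≤ 2 ∧
      ∀ S ∈ approximableOperators 𝕜 X Y, 1 ≤ ‖T' - S‖ := by
  set A := approximableOperators 𝕜 X Y with hA
  have hcl : IsClosed (A : Set (X →L[𝕜] Y)) := Submodule.isClosed_topologicalClosure _
  have hne : (A : Set (X →L[𝕜] Y)).Nonempty := ⟨0, A.zero_mem⟩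
  set d := Metric.infDist T A with hd
  have hd0 : 0 < d := (hcl.notMem_iff_infDist_pos hne).1 hT
  -- Subtracting an approximable operator that is within twice the distance, then dividing by the
  -- distance, gives norm at most 2 and distance at least 1.
  obtain ⟨S₀, hS₀, hlt⟩ := (Metric.infDist_lt_iff hne (r := 2 * d)).1 (by linarith : d < 2 * d)
  have hdk : ‖((d : ℝ) : 𝕜)‖ = d := by rw [RCLike.norm_ofReal, abs_of_pos hd0]
  have hdk0 : ((d : ℝ) : 𝕜) ≠ 0 := by rw [Ne, RCLike.ofReal_eq_zero]; exact hd0.ne'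
  refine ⟨((d : ℝ) : 𝕜)⁻¹ • (T - S₀), ?_, ?_, ?_⟩
  · exact Submodule.smul_mem (compactOperators 𝕜 X Y) _ (Submodule.sub_mem _ hc
      (approximableOperators_le_compactOperators 𝕜 X Y hS₀))
  · rw [norm_smul, norm_inv, hdk, inv_mul_le_iff₀ hd0, ← dist_eq_norm]
    linarith
  · intro S hS
    have h1 : ((d : ℝ) : 𝕜)⁻¹ • (T - S₀) - S =
        ((d : ℝ) : 𝕜)⁻¹ • (T - (S₀ + ((d : ℝ) : 𝕜) • S)) := by
      rw [← sub_sub, smul_sub _ (T - S₀), inv_smul_smul₀ hdk0]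
    rw [h1, norm_smul, norm_inv, hdk, le_inv_mul_iff₀ hd0, mul_one, ← dist_eq_norm]
    exact Metric.infDist_le_dist_of_mem (A.add_mem hS₀ (A.smul_mem _ hS))

end NonApproximable

/-! ### From one bad pair of subspaces to a continuum. -/

section Hyperplanes

variable {𝕜 : Type*} [RCLike 𝕜] {Y : Type*} [NormedAddCommGroup Y] [NormedSpace 𝕜 Y]

/-- The intersection of a subspace with the kernel of a functional. -/
def hyperplane (W : Submodule 𝕜 Y) (f : Y →L[𝕜] 𝕜) : Submodule 𝕜 Y :=
  W ⊓ LinearMap.ker (f : Y →ₗ[𝕜] 𝕜)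

theorem mem_hyperplane {W : Submodule 𝕜 Y} {f : Y →L[𝕜] 𝕜} {x : Y} :
    x ∈ hyperplane W f ↔ x ∈ W ∧ f x = 0 := Iff.rfl

theorem isClosed_hyperplane {W : Submodule 𝕜 Y} (hW : IsClosed (W : Set Y)) (f : Y →L[𝕜] 𝕜) :
    IsClosed (hyperplane W f : Set Y) := hW.inter f.isClosed_ker

/-- The inclusion of a hyperplane. -/
def hyperplaneIncl (W : Submodule 𝕜 Y) (f : Y →L[𝕜] 𝕜) : hyperplane W f →L[𝕜] W :=
  (hyperplane W f).subtypeL.codRestrict W fun x => x.2.1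

/-- The projection to a hyperplane along a vector. -/
def hyperplaneProj (W : Submodule 𝕜 Y) (f : Y →L[𝕜] 𝕜) {x : Y} (hx : x ∈ W) (hfx : f x = 1) :
    W →L[𝕜] hyperplane W f :=
  (W.subtypeL - (f.comp W.subtypeL).smulRight x).codRestrict (hyperplane W f) fun w =>
    ⟨W.sub_mem w.2 (W.smul_mem _ hx), by simp [hfx]⟩

theorem hyperplaneIncl_comp_proj (W : Submodule 𝕜 Y) (f : Y →L[𝕜] 𝕜) {x : Y} (hx : x ∈ W)
    (hfx : f x = 1) : (hyperplaneIncl W f).comp (hyperplaneProj W f hx hfx) =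
      ContinuousLinearMap.id 𝕜 W - (f.comp W.subtypeL).smulRight ⟨x, hx⟩ := by
  ext w
  rfl

/-- Passing to hyperplanes in the domain and the codomain, an operator which is not approximable
stays so. -/
theorem hyperplane_notMem_approximableOperators {W V : Submodule 𝕜 Y} {T : W →L[𝕜] V}
    (hT : T ∉ approximableOperators 𝕜 W V) {f g : Y →L[𝕜] 𝕜} {x y : Y} (hx : x ∈ W)
    (hfx : f x = 1) (hy : y ∈ V) (hgy : g y = 1) :
    (hyperplaneProj V g hy hgy).comp (T.comp (hyperplaneIncl W f)) ∉
      approximableOperators 𝕜 (hyperplane W f) (hyperplane V g) := by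
  intro h
  apply hT
  have h1 := comp_clm_mem_approximableOperators
    (clm_comp_mem_approximableOperators (hyperplaneIncl V g) h) (hyperplaneProj W f hx hfx)
  have h2 : (((hyperplaneIncl V g).comp ((hyperplaneProj V g hy hgy).comp
      (T.comp (hyperplaneIncl W f)))).comp (hyperplaneProj W f hx hfx)) =
      ((hyperplaneIncl V g).comp (hyperplaneProj V g hy hgy)).comp
        (T.comp ((hyperplaneIncl W f).comp (hyperplaneProj W f hx hfx))) := rfl
  rw [h2, hyperplaneIncl_comp_proj, hyperplaneIncl_comp_proj] at h1
  set P := (g.comp V.subtypeL).smulRight (⟨y, hy⟩ : V) with hP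
  set Q := (f.comp W.subtypeL).smulRight (⟨x, hx⟩ : W) with hQ
  -- Compression to the hyperplanes changes `T` only by operators that factor through the rank one
  -- projections `P` and `Q`.
  have h3 : T = (ContinuousLinearMap.id 𝕜 V - P).comp (T.comp (ContinuousLinearMap.id 𝕜 W - Q)) +
      (T.comp Q + P.comp (T.comp (ContinuousLinearMap.id 𝕜 W - Q))) := by
    simp only [ContinuousLinearMap.sub_comp, ContinuousLinearMap.comp_sub,
      ContinuousLinearMap.id_comp, ContinuousLinearMap.comp_id]
    abel
  rw [h3]
  exact Submodule.add_mem _ h1 (Submodule.add_mem _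
    (clm_comp_mem_approximableOperators _ (smulRight_mem_approximableOperators _ _))
    (comp_clm_mem_approximableOperators (smulRight_mem_approximableOperators _ _) _))

/-- An infinite-dimensional subspace has a continuum of hyperplanes. -/
theorem exists_injective_hyperplane (W : Submodule 𝕜 Y) (hW : ¬ FiniteDimensional 𝕜 W) :
    ∃ x ∈ W, ∃ f : ℝ → Y →L[𝕜] 𝕜, (∀ t, f t x = 1) ∧
      Function.Injective fun t => hyperplane W (f t) := by
  have hW0 : W ≠ ⊥ := by
    rintro rfl
    exact hW inferInstance
  obtain ⟨x, hxW, hx0⟩ := Submodule.exists_mem_ne_zero_of_ne_bot hW0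
  obtain ⟨f, hfx⟩ := SeparatingDual.exists_eq_one (R := 𝕜) hx0
  have : ∃ y ∈ W, f y = 0 ∧ y ≠ 0 := by
    by_contra! hcon
    apply hW
    refine Submodule.finiteDimensional_of_le (S₂ := Submodule.span 𝕜 {x}) fun w hw => ?_
    have h := hcon (w - f w • x) (W.sub_mem hw (W.smul_mem _ hxW)) (by simp [hfx])
    rw [Submodule.mem_span_singleton]
    exact ⟨f w, (sub_eq_zero.1 h).symm⟩
  obtain ⟨y, hyW, hfy, hy0⟩ := this
  obtain ⟨g₀, hgy₀⟩ := SeparatingDual.exists_eq_one (R := 𝕜) hy0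
  obtain ⟨g, hgx, hgy⟩ : ∃ g : Y →L[𝕜] 𝕜, g x = 0 ∧ g y = 1 :=
    ⟨g₀ - g₀ x • f, by simp [hfx], by simp [hfy, hgy₀]⟩
  have happ : ∀ (t : ℝ) (v : Y), (f + (t : 𝕜) • g) v = f v + (t : 𝕜) * g v := fun t v => rfl
  -- The vector `t • x - y` lies in the kernel of the functional with parameter `t'` only for `t' =
  -- t`, so it distinguishes the hyperplanes.
  have hval : ∀ t t' : ℝ, (f + (t' : 𝕜) • g) ((t : 𝕜) • x - y) = (t : 𝕜) - t' := fun t t' => by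
    rw [happ, map_sub, map_sub, map_smul, map_smul, hfx, hfy, hgx, hgy]
    simp only [smul_eq_mul]
    ring
  refine ⟨x, hxW, fun t => f + (t : 𝕜) • g, fun t => ?_, fun t t' h => ?_⟩
  · rw [happ, hfx, hgx, mul_zero, add_zero]
  · have hmem : (t : 𝕜) • x - y ∈ hyperplane W (f + (t : 𝕜) • g) :=
      mem_hyperplane.2 ⟨W.sub_mem (W.smul_mem _ hxW) hyW, by rw [hval, sub_self]⟩
    have h' : hyperplane W (f + (t : 𝕜) • g) = hyperplane W (f + (t' : 𝕜) • g) := h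
    rw [h', mem_hyperplane, hval] at hmem
    exact RCLike.ofReal_injective (sub_eq_zero.1 hmem.2)

/-- If there is a compact operator between closed subspaces which is not approximable, then there
is a continuum of such pairs of subspaces, all distinct. -/
theorem exists_real_family_of_notMem_approximableOperators [CompleteSpace Y]
    {W V : Submodule 𝕜 Y} (hW : IsClosed (W : Set Y)) (hV : IsClosed (V : Set Y))
    {T : W →L[𝕜] V} (hc : IsCompactOperator T) (hT : T ∉ approximableOperators 𝕜 W V) :
    ∃ (a b : ℝ → ClosedInfDimSubspace 𝕜 Y) (R : ∀ t, (a t).1 →L[𝕜] (b t).1),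
      Function.Injective a ∧ Function.Injective b ∧ ∀ t, IsCompactOperator (R t) ∧ ‖R t‖ ≤ 2 ∧
        ∀ S ∈ approximableOperators 𝕜 (a t).1 (b t).1, 1 ≤ ‖R t - S‖ := by
  obtain ⟨x, hx, f, hfx, hfinj⟩ := exists_injective_hyperplane W fun h =>
    hT (mem_approximableOperators_of_finiteDimensional_dom T)
  obtain ⟨y, hy, g, hgy, hginj⟩ := exists_injective_hyperplane V fun h =>
    hT (mem_approximableOperators_of_finiteDimensional_cod T)
  have hna := fun t => hyperplane_notMem_approximableOperators hT hx (hfx t) hy (hgy t)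
  have hco : ∀ t, IsCompactOperator
      ((hyperplaneProj V (g t) hy (hgy t)).comp (T.comp (hyperplaneIncl W (f t)))) := fun t =>
    (hc.comp_clm (hyperplaneIncl W (f t))).clm_comp (hyperplaneProj V (g t) hy (hgy t))
  have hcomp : ∀ t, CompleteSpace (hyperplane V (g t)) := fun t =>
    (isClosed_hyperplane hV (g t)).completeSpace_coe
  choose R hR using fun t => exists_normalized_of_notMem_approximableOperators (hco t) (hna t)
  refine ⟨fun t => ⟨hyperplane W (f t), isClosed_hyperplane hW _, fun h =>
      hna t (mem_approximableOperators_of_finiteDimensional_dom _)⟩,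
    fun t => ⟨hyperplane V (g t), isClosed_hyperplane hV _, fun h =>
      hna t (mem_approximableOperators_of_finiteDimensional_cod _)⟩, R,
    fun t t' h => hfinj (congrArg Subtype.val h), fun t t' h => hginj (congrArg Subtype.val h), hR⟩

end Hyperplanes

/-! ### Norm estimates in direct sums. -/

section DirectSumOperators

open Filter

variable {𝕜 : Type*} [RCLike 𝕜] {ι : Type*} {E : ι → Type*}
  [∀ i, NormedAddCommGroup (E i)] [∀ i, NormedSpace 𝕜 (E i)] {p : ℝ≥0∞} [hp : Fact (1 ≤ p)]

theorem isClosed_lpDirectSum : IsClosed (lpDirectSum 𝕜 E p : Set (lp E p)) := by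
  by_cases h : p = ∞
  · have hcl := isClosed_setOf_tendsto_zero_of_lipschitz cofinite
      (fun i (x : lp E p) => ‖x i‖) 1 fun i x y => by
        rw [one_mul, Real.norm_eq_abs]
        exact (abs_norm_sub_norm_le (x i) (y i)).trans
          (lp.norm_apply_le_norm (zero_lt_one.trans_le hp.out).ne' (x - y) i)
    convert hcl using 1
    ext x
    exact ⟨fun hx => hx h, fun hx _ => hx⟩
  · convert isClosed_univ using 1
    ext x
    exact ⟨fun _ => trivial, fun _ h' => absurd h' h⟩

instance completeSpace_lpDirectSum [∀ i, CompleteSpace (E i)] :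
    CompleteSpace (lpDirectSum 𝕜 E p) :=
  isClosed_lpDirectSum.completeSpace_coe

variable (𝕜 E p) in
/-- The coordinate projections of a direct sum. -/
noncomputable def directSumProj (i : ι) : lpDirectSum 𝕜 E p →L[𝕜] E i :=
  LinearMap.mkContinuous
    { toFun := fun x => x.1 i
      map_add' := fun _ _ => rfl
      map_smul' := fun _ _ => rfl } 1 fun x => by
    rw [one_mul]
    exact lp.norm_apply_le_norm (zero_lt_one.trans_le hp.out).ne' x.1 i

theorem norm_directSumProj_le (i : ι) : ‖directSumProj 𝕜 E p i‖ ≤ 1 :=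
  LinearMap.mkContinuous_norm_le _ zero_le_one _

open Classical in
theorem single_mem_lpDirectSum (i : ι) (x : E i) : lp.single p i x ∈ lpDirectSum 𝕜 E p := by
  intro _
  refine (tendsto_congr' ?_).2 tendsto_const_nhds
  filter_upwards [(Set.finite_singleton i).compl_mem_cofinite] with j hj
  rw [lp.single_apply_ne p i x hj, norm_zero]

open Classical in
variable (𝕜 E p) in
/-- The coordinate inclusions of a direct sum. -/
noncomputable def directSumSingle (i : ι) : E i →L[𝕜] lpDirectSum 𝕜 E p :=
  (lp.singleContinuousLinearMap 𝕜 E p i).codRestrict _ fun x => single_mem_lpDirectSum i x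

open Classical in
theorem coe_directSumSingle (i : ι) (x : E i) :
    (directSumSingle 𝕜 E p i x : lp E p) = lp.single p i x := rfl

theorem norm_directSumSingle_apply (i : ι) (x : E i) : ‖directSumSingle 𝕜 E p i x‖ = ‖x‖ := by
  classical
  exact lp.norm_single (zero_lt_one.trans_le hp.out) i x

theorem norm_directSumSingle_le (i : ι) : ‖directSumSingle 𝕜 E p i‖ ≤ 1 :=
  ContinuousLinearMap.opNorm_le_bound _ zero_le_one fun x => by
    rw [norm_directSumSingle_apply, one_mul]

theorem directSumProj_single_self (i : ι) (x : E i) :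
    directSumProj 𝕜 E p i (directSumSingle 𝕜 E p i x) = x := by
  classical
  exact lp.single_apply_self p i x

theorem directSumProj_single_of_ne {i j : ι} (h : j ≠ i) (x : E i) :
    directSumProj 𝕜 E p j (directSumSingle 𝕜 E p i x) = 0 := by
  classical
  exact lp.single_apply_ne p i x h

/-- A vector assembled from finitely many components which are dominated by different components
of `x` is dominated by `x`. -/
theorem norm_sum_directSumSingle_le {Γ : Type*} {a b : Γ → ι} (ha : Function.Injective a)
    (hb : Function.Injective b) (F : Finset Γ) (y : ∀ t, E (b t)) (x : lpDirectSum 𝕜 E p) {K : ℝ}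
    (hK : 0 ≤ K) (h : ∀ t ∈ F, ‖y t‖ ≤ K * ‖x.1 (a t)‖) :
    ‖∑ t ∈ F, directSumSingle 𝕜 E p (b t) (y t)‖ ≤ K * ‖x‖ := by
  classical
  -- Since `b` is injective, the components `y t` extend by zero to one family over all of `ι`.
  have hext : ∀ i, ∃ e : E i, ∀ t (ht : b t = i), ht ▸ y t = e := by
    intro i
    by_cases hi : ∃ t, b t = i
    · obtain ⟨t, rfl⟩ := hi
      refine ⟨y t, fun t' ht' => ?_⟩
      obtain rfl := hb ht'
      rfl
    · exact ⟨0, fun t ht => absurd ⟨t, ht⟩ hi⟩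
  choose f hf using hext
  have hfb : ∀ t, f (b t) = y t := fun t => (hf (b t) t rfl).symm
  have hsum : ((∑ t ∈ F, directSumSingle 𝕜 E p (b t) (y t) : lpDirectSum 𝕜 E p) : lp E p) =
      ∑ i ∈ F.map ⟨b, hb⟩, lp.single p i (f i) := by
    rw [Finset.sum_map, Submodule.coe_sum]
    refine Finset.sum_congr rfl fun t _ => ?_
    rw [coe_directSumSingle, Function.Embedding.coeFn_mk, hfb]
  change ‖((∑ t ∈ F, directSumSingle 𝕜 E p (b t) (y t) : lpDirectSum 𝕜 E p) : lp E p)‖ ≤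
    K * ‖x.1‖
  rw [hsum]
  rcases eq_or_ne p ∞ with rfl | hpt
  · refine lp.norm_le_of_forall_le (by positivity) fun i => ?_
    rw [lp.coeFn_sum, Finset.sum_apply]
    by_cases hi : i ∈ F.map ⟨b, hb⟩
    · rw [Finset.sum_eq_single i (fun j _ hj => lp.single_apply_ne _ _ _ hj.symm)
        (fun h' => absurd hi h'), lp.single_apply_self]
      obtain ⟨t, ht, rfl⟩ := Finset.mem_map.1 hi
      change ‖f (b t)‖ ≤ _
      rw [hfb]
      exact (h t ht).trans (mul_le_mul_of_nonneg_left
        (lp.norm_apply_le_norm ENNReal.top_ne_zero x.1 (a t)) hK)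
    · rw [Finset.sum_eq_zero fun j hj => lp.single_apply_ne _ _ _ (by rintro rfl; exact hi hj),
        norm_zero]
      positivity
  · have hp0 : 0 < p.toReal :=
      ENNReal.toReal_pos (zero_lt_one.trans_le hp.out).ne' hpt
    rw [← Real.rpow_le_rpow_iff (norm_nonneg _) (by positivity) hp0, lp.norm_sum_single hp0,
      Finset.sum_map, Real.mul_rpow hK (norm_nonneg _)]
    calc _ ≤ ∑ t ∈ F, K ^ p.toReal * ‖x.1 (a t)‖ ^ p.toReal := by
          refine Finset.sum_le_sum fun t ht => ?_
          rw [Function.Embedding.coeFn_mk, hfb, ← Real.mul_rpow hK (norm_nonneg _)]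
          exact Real.rpow_le_rpow (norm_nonneg _) (h t ht) hp0.le
      _ = K ^ p.toReal * ∑ i ∈ F.map ⟨a, ha⟩, ‖x.1 i‖ ^ p.toReal := by
          rw [← Finset.mul_sum, Finset.sum_map]
          rfl
      _ ≤ _ := mul_le_mul_of_nonneg_left (lp.sum_rpow_le_norm_rpow hp0 x.1 _)
          (Real.rpow_nonneg hK _)

end DirectSumOperators

/-! ### Embedding null families into the quotient algebra. -/

section SumSystems

open Filter

/-- Coordinate inclusions and projections of a normed space `Z` which behave as those of a direct
sum of the spaces `E i` with an unconditional symmetric norm. -/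
structure SumSystem (𝕜 : Type*) [RCLike 𝕜] {ι : Type*} (E : ι → Type*)
    [∀ i, NormedAddCommGroup (E i)] [∀ i, NormedSpace 𝕜 (E i)] (Z : Type*) [NormedAddCommGroup Z]
    [NormedSpace 𝕜 Z] where
  /-- the coordinate inclusions -/
  single : ∀ i, E i →L[𝕜] Z
  /-- the coordinate projections -/
  proj : ∀ i, Z →L[𝕜] E i
  norm_single_le : ∀ i, ‖single i‖ ≤ 1
  norm_proj_le : ∀ i, ‖proj i‖ ≤ 1
  proj_single_self : ∀ i x, proj i (single i x) = x
  proj_single_of_ne : ∀ i j, j ≠ i → ∀ x, proj j (single i x) = 0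
  -- Two injections are needed because an entry operator moves the summand `a t` to the summand `b
  -- t`.
  norm_sum_single_le : ∀ {Γ : Type} {a b : Γ → ι}, Function.Injective a → Function.Injective b →
    ∀ (F : Finset Γ) (y : ∀ t, E (b t)) (x : Z) {K : ℝ}, 0 ≤ K →
      (∀ t ∈ F, ‖y t‖ ≤ K * ‖proj (a t) x‖) → ‖∑ t ∈ F, single (b t) (y t)‖ ≤ K * ‖x‖

/-- Coordinate functionals of a normed space `C` which behave as those of `c₀(Γ)`. -/
structure NullSystem (𝕜 : Type*) [RCLike 𝕜] (Γ : Type*) (C : Type*) [NormedAddCommGroup C]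
    [NormedSpace 𝕜 C] where
  /-- the coordinate functionals -/
  coord : Γ → C →L[𝕜] 𝕜
  norm_coord_apply_le : ∀ t c, ‖coord t c‖ ≤ ‖c‖
  norm_le : ∀ c {K : ℝ}, 0 ≤ K → (∀ t, ‖coord t c‖ ≤ K) → ‖c‖ ≤ K
  tendsto_coord : ∀ c, Tendsto (fun t => ‖coord t c‖) cofinite (𝓝 0)

/-- The coordinate inclusions and projections of an `ℓ^p`-sum. -/
noncomputable def lpDirectSum.sumSystem (𝕜 : Type*) [RCLike 𝕜] {ι : Type*} (E : ι → Type*)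
    [∀ i, NormedAddCommGroup (E i)] [∀ i, NormedSpace 𝕜 (E i)] (p : ℝ≥0∞) [Fact (1 ≤ p)] :
    SumSystem 𝕜 E (lpDirectSum 𝕜 E p) where
  single := directSumSingle 𝕜 E p
  proj := directSumProj 𝕜 E p
  norm_single_le := norm_directSumSingle_le
  norm_proj_le := norm_directSumProj_le
  proj_single_self := directSumProj_single_self
  proj_single_of_ne := fun _ _ h x => directSumProj_single_of_ne h x
  norm_sum_single_le := fun ha hb F y x _ hK h => norm_sum_directSumSingle_le ha hb F y x hK h

/-- The coordinate functionals of `c₀(Γ)`. -/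
noncomputable def cZero.nullSystem (𝕜 : Type*) [RCLike 𝕜] (Γ : Type*) :
    NullSystem 𝕜 Γ (cZero 𝕜 Γ) where
  coord := directSumProj 𝕜 (fun _ : Γ => 𝕜) ∞
  norm_coord_apply_le := fun t c => lp.norm_apply_le_norm ENNReal.top_ne_zero c.1 t
  norm_le := fun c _ hK h => lp.norm_le_of_forall_le (f := c.1) hK h
  tendsto_coord := fun c => c.2 rfl

namespace SumSystem

variable {𝕜 : Type*} [RCLike 𝕜] {ι : Type*} {E : ι → Type*}
  [∀ i, NormedAddCommGroup (E i)] [∀ i, NormedSpace 𝕜 (E i)] {Z : Type*} [NormedAddCommGroup Z]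
  [NormedSpace 𝕜 Z] (D : SumSystem 𝕜 E Z) {Γ : Type} {a b : Γ → ι}
  (R : ∀ t, E (a t) →L[𝕜] E (b t))

/-- An operator between two summands, as an operator on the direct sum. -/
noncomputable def entry (t : Γ) : Z →L[𝕜] Z := (D.single (b t)).comp ((R t).comp (D.proj (a t)))

theorem norm_sum_entry_le (ha : Function.Injective a) (hb : Function.Injective b)
    (hR : ∀ t, ‖R t‖ ≤ 2) (F : Finset Γ) (c : Γ → 𝕜) {C : ℝ} (hC : 0 ≤ C)
    (hc : ∀ t ∈ F, ‖c t‖ ≤ C) : ‖∑ t ∈ F, c t • D.entry R t‖ ≤ 2 * C := by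
  refine ContinuousLinearMap.opNorm_le_bound _ (by positivity) fun x => ?_
  have : (∑ t ∈ F, c t • D.entry R t) x =
      ∑ t ∈ F, D.single (b t) (c t • R t (D.proj (a t) x)) := by
    rw [sum_apply]
    refine Finset.sum_congr rfl fun t _ => ?_
    rw [map_smul]
    rfl
  rw [this]
  refine D.norm_sum_single_le ha hb F _ x (by positivity) fun t ht => ?_
  rw [norm_smul]
  calc ‖c t‖ * ‖R t (D.proj (a t) x)‖ ≤ C * (2 * ‖D.proj (a t) x‖) :=
        mul_le_mul (hc t ht) ((R t).le_of_opNorm_le (hR t) _) (norm_nonneg _) hC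
    _ = _ := by ring

variable {C : Type*} [NormedAddCommGroup C] [NormedSpace 𝕜 C] (N : NullSystem 𝕜 Γ C)

/-- The norm of a finite sum is at most twice its largest coefficient, so tails of a null family are
small. The sum need not converge absolutely. -/
theorem summable_entry [CompleteSpace Z] (ha : Function.Injective a) (hb : Function.Injective b)
    (hR : ∀ t, ‖R t‖ ≤ 2) (c : C) : Summable fun t => N.coord t c • D.entry R t := by
  rw [summable_iff_vanishing_norm]
  intro ε hε
  have hfin : {t | ¬ ‖N.coord t c‖ < ε / 3}.Finite := eventually_cofinite.1
    ((N.tendsto_coord c).eventually (gt_mem_nhds (by positivity : (0 : ℝ) < ε / 3)))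
  refine ⟨hfin.toFinset, fun F hF => ?_⟩
  refine (D.norm_sum_entry_le R ha hb hR F (fun t => N.coord t c) (C := ε / 3) (by positivity)
    fun t ht => ?_).trans_lt (by linarith)
  by_contra hcon
  exact Finset.disjoint_left.1 hF ht (hfin.mem_toFinset.2 fun h => hcon h.le)

/-- The diagonal operators on a direct sum which are formed with a family of operators between
summands and the coefficients of a null family. -/
theorem exists_diagonal [CompleteSpace Z] (ha : Function.Injective a) (hb : Function.Injective b)
    (hR : ∀ t, ‖R t‖ ≤ 2) : ∃ Φ : C →L[𝕜] (Z →L[𝕜] Z),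
      ∀ c, HasSum (fun t => N.coord t c • D.entry R t) (Φ c) := by
  have hs := D.summable_entry R N ha hb hR
  refine ⟨LinearMap.mkContinuous
    { toFun := fun c => ∑' t, N.coord t c • D.entry R t
      map_add' := fun c c' => ?_
      map_smul' := fun k c => ?_ } 2 fun c => ?_, fun c => (hs c).hasSum⟩
  · rw [← (hs c).tsum_add (hs c')]
    exact tsum_congr fun t => by rw [map_add, add_smul]
  · rw [RingHom.id_apply, ← (hs c).tsum_const_smul k]
    exact tsum_congr fun t => by rw [map_smul, smul_assoc]
  · have h := (continuous_norm.tendsto _).comp (hs c).hasSum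
    exact le_of_tendsto h (Eventually.of_forall fun F => D.norm_sum_entry_le R ha hb hR F _
      (norm_nonneg c) fun t _ => N.norm_coord_apply_le t c)

theorem isCompactOperator_of_hasSum [CompleteSpace Z] (hRc : ∀ t, IsCompactOperator (R t))
    {c : Γ → 𝕜} {T : Z →L[𝕜] Z} (hT : HasSum (fun t => c t • D.entry R t) T) :
    T ∈ compactOperators 𝕜 Z Z := by
  have hcl : IsClosed (compactOperators 𝕜 Z Z : Set (Z →L[𝕜] Z)) :=
    isClosed_setOfPred_isCompactOperator
  refine hcl.mem_of_tendsto hT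
    (Eventually.of_forall fun s => Submodule.sum_mem _ fun t _ => Submodule.smul_mem _ _ ?_)
  exact ((hRc t).comp_clm (D.proj (a t))).clm_comp (D.single (b t))

/-- Distinct indices have distinct target summands, so the projection to `b t` retains only the term
of index t. -/
theorem proj_comp_single_of_hasSum (hb : Function.Injective b)
    {c : Γ → 𝕜} {T : Z →L[𝕜] Z} (hT : HasSum (fun t => c t • D.entry R t) T) (t : Γ) :
    (D.proj (b t)).comp (T.comp (D.single (a t))) = c t • R t := by
  ext x
  let ev : (Z →L[𝕜] Z) →L[𝕜] E (b t) :=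
    (D.proj (b t)).comp (ContinuousLinearMap.apply 𝕜 _ (D.single (a t) x))
  have h := ev.hasSum hT
  have hval : ∀ r, ev (c r • D.entry R r) = c r • D.proj (b t)
      (D.single (b r) (R r (D.proj (a r) (D.single (a t) x)))) := fun r => by
    rw [map_smul]; rfl
  have h' := hasSum_single (f := fun r => ev (c r • D.entry R r)) t fun r hr => by
    rw [hval, D.proj_single_of_ne _ _ (hb.ne hr.symm), smul_zero]
  refine (h.unique h').trans ?_
  rw [hval, D.proj_single_self, D.proj_single_self]
  rfl

/-- If a family of pairs of summands carries compact operators at a uniform distance from the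
approximable operators, then the null families embed into the quotient algebra. -/
theorem isomorphicallyEmbeds_compactByApproximable [CompleteSpace Z] (D : SumSystem 𝕜 E Z)
    (R : ∀ t, E (a t) →L[𝕜] E (b t)) (N : NullSystem 𝕜 Γ C)
    (ha : Function.Injective a) (hb : Function.Injective b)
    (hR : ∀ t, IsCompactOperator (R t) ∧ ‖R t‖ ≤ 2 ∧
      ∀ S ∈ approximableOperators 𝕜 (E (a t)) (E (b t)), 1 ≤ ‖R t - S‖) :
    IsomorphicallyEmbeds 𝕜 C (CompactByApproximable 𝕜 Z) := by
  obtain ⟨Ψ, hΨ⟩ := D.exists_diagonal R N ha hb fun t => (hR t).2.1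
  let Ψ' : C →ₗ[𝕜] compactOperators 𝕜 Z Z := Ψ.toLinearMap.codRestrict _
    fun c => D.isCompactOperator_of_hasSum R (fun t => (hR t).1) (hΨ c)
  let A := (approximableOperators 𝕜 Z Z).submoduleOf (compactOperators 𝕜 Z Z)
  let Φ : C →L[𝕜] CompactByApproximable 𝕜 Z :=
    LinearMap.mkContinuous (A.mkQ ∘ₗ Ψ') ‖Ψ‖ fun c =>
      (Submodule.Quotient.norm_mk_le A (Ψ' c)).trans (Ψ.le_opNorm c)
  refine ⟨Φ, 1, one_pos, fun c => ?_⟩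
  rw [one_mul]
  refine N.norm_le c (norm_nonneg _) fun t => ?_
  refine le_of_forall_pos_le_add fun ε hε => ?_
  -- It suffices to bound each coefficient by the norm of a nearly optimal representative.
  -- Compressed to one entry, it is the coefficient times `R t` minus an approximable operator, and
  -- compression does not increase norms.
  obtain ⟨m, hm, hmlt⟩ : ∃ m : compactOperators 𝕜 Z Z, A.mkQ m = Φ c ∧ ‖m‖ < ‖Φ c‖ + ε :=
    Submodule.Quotient.norm_mk_lt (S := A) (Φ c) hε
  have hmem : Ψ' c - m ∈ A := by
    rw [← Submodule.Quotient.eq]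
    exact hm.symm
  have hmem' : Ψ c - m.1 ∈ approximableOperators 𝕜 Z Z := hmem
  refine le_trans ?_ hmlt.le
  change _ ≤ ‖m.1‖
  set S := Ψ c - m.1 with hS
  by_cases hct : N.coord t c = 0
  · rw [hct, norm_zero]; exact norm_nonneg _
  let P := D.proj (b t)
  let J := D.single (a t)
  have hPS : P.comp (S.comp J) ∈ approximableOperators 𝕜 (E (a t)) (E (b t)) :=
    clm_comp_mem_approximableOperators _ (comp_clm_mem_approximableOperators hmem' _)
  have hPm : P.comp (m.1.comp J) =
      N.coord t c • (R t - (N.coord t c)⁻¹ • P.comp (S.comp J)) := by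
    rw [smul_sub, smul_inv_smul₀ hct, ← D.proj_comp_single_of_hasSum R hb (hΨ c) t, hS,
      ContinuousLinearMap.sub_comp, ContinuousLinearMap.comp_sub]
    exact (sub_sub_cancel _ _).symm
  have h1 : ‖N.coord t c‖ ≤ ‖P.comp (m.1.comp J)‖ := by
    rw [hPm, norm_smul]
    exact le_mul_of_one_le_right (norm_nonneg _)
      ((hR t).2.2 _ (Submodule.smul_mem _ _ hPS))
  have h2 : ‖P.comp (m.1.comp J)‖ ≤ 1 * (‖m.1‖ * 1) :=
    (ContinuousLinearMap.opNorm_comp_le _ _).trans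
      (mul_le_mul (D.norm_proj_le _)
        ((ContinuousLinearMap.opNorm_comp_le _ _).trans
          (mul_le_mul_of_nonneg_left (D.norm_single_le _) (norm_nonneg _)))
        (norm_nonneg _) zero_le_one)
  rw [one_mul, mul_one] at h2
  exact h1.trans h2

end SumSystem

/-- A space containing a copy of a space with an uncountable separated family is not separable. -/
theorem IsomorphicallyEmbeds.not_separableSpace {𝕜 : Type*} [RCLike 𝕜] {Γ : Type*} [Uncountable Γ]
    {C Q : Type*} [NormedAddCommGroup C] [NormedSpace 𝕜 C] [NormedAddCommGroup Q] [NormedSpace 𝕜 Q]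
    (h : IsomorphicallyEmbeds 𝕜 C Q) {e : Γ → C} (he : ∀ s t, s ≠ t → 1 ≤ ‖e s - e t‖) :
    ¬ TopologicalSpace.SeparableSpace Q := by
  intro hsep
  obtain ⟨Φ, c, hc, hΦ⟩ := h
  have hdist : ∀ s t, s ≠ t → c ≤ dist (Φ (e s)) (Φ (e t)) := by
    intro s t hst
    rw [dist_eq_norm, ← map_sub]
    exact (le_mul_of_one_le_right hc.le (he s t hst)).trans (hΦ _)
  have hdisj : Pairwise (Function.onFun Disjoint fun t => Metric.ball (Φ (e t)) (c / 2)) := by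
    intro s t hst
    refine Metric.ball_disjoint_ball ?_
    rw [add_halves]
    exact hdist s t hst
  have := hdisj.countable_of_isOpen_disjoint (fun t => Metric.isOpen_ball)
    fun t => ⟨_, Metric.mem_ball_self (half_pos hc)⟩
  exact not_countable this

/-- Shows that the unit vectors are 1-separated, as required for non-separability of the quotient.
-/
theorem SumSystem.one_le_norm_single_sub {𝕜 : Type*} [RCLike 𝕜] {Γ : Type*} {C : Type*}
    [NormedAddCommGroup C] [NormedSpace 𝕜 C] (D : SumSystem 𝕜 (fun _ : Γ => 𝕜) C) {s t : Γ}
    (hst : s ≠ t) : 1 ≤ ‖D.single s 1 - D.single t 1‖ := by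
  have h1 := (D.proj s).le_of_opNorm_le (D.norm_proj_le s) (D.single s 1 - D.single t 1)
  rwa [map_sub, D.proj_single_self, D.proj_single_of_ne _ _ hst, sub_zero, norm_one, one_mul] at h1

end SumSystems

/-! ### Blocks inside Johnson's space, and the theorem. -/

section JohnsonSpaces

/-- A sequence of indices can be realised injectively in a listing with infinite repetitions. -/
theorem exists_injective_section_of_infinite_fibers {s : ℕ → ℕ} (hs : ∀ n, {m | s m = n}.Infinite)
    (k : ℕ → ℕ) : ∃ m : ℕ → ℕ, Function.Injective m ∧ ∀ n, s (m n) = k n := by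
  choose g hg hgt using fun n N => (hs n).exists_gt N
  -- Each position is chosen beyond the previous one, so the section is strictly increasing.
  let m : ℕ → ℕ := fun n => Nat.rec (g (k 0) 0) (fun i r => g (k (i + 1)) r) n
  refine ⟨m, (strictMono_nat_of_lt_succ fun n => hgt (k (n + 1)) (m n)).injective, fun n => ?_⟩
  cases n with
  | zero => exact hg (k 0) 0
  | succ n => exact hg (k (n + 1)) (m n)

variable {𝕜 : Type u} [RCLike 𝕜] {E : ℕ → Type v} [∀ n, NormedAddCommGroup (E n)]
  [∀ n, NormedSpace 𝕜 (E n)]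

/-- Johnson's spaces contain the blocks of functions uniformly. -/
theorem SumSystem.nonempty_blockSystem (hE : IsBanachMazurDense 𝕜 E) {s : ℕ → ℕ}
    (hs : ∀ n, {m | s m = n}.Infinite) {Y : Type*} [NormedAddCommGroup Y] [NormedSpace 𝕜 Y]
    (D : SumSystem 𝕜 (fun m => E (s m)) Y) : Nonempty (BlockSystem 𝕜 Y) := by
  have h1 : ∀ n, ∃ k, banachMazurDist 𝕜 (E k) (BlockPoint n → 𝕜) < 2 := fun n =>
    hE (BlockPoint n → 𝕜) 2 (by norm_num)
  choose k hk using h1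
  obtain ⟨m, hm, hmk⟩ := exists_injective_section_of_infinite_fibers hs k
  have h2 : ∀ n, ∃ T : E (s (m n)) ≃L[𝕜] (BlockPoint n → 𝕜),
      ‖(T : E (s (m n)) →L[𝕜] (BlockPoint n → 𝕜))‖ *
        ‖(T.symm : (BlockPoint n → 𝕜) →L[𝕜] E (s (m n)))‖ ≤ 2 := by
    intro n
    have h := hk n
    rw [← hmk n, banachMazurDist, iInf_lt_iff] at h
    obtain ⟨T, hT⟩ := h
    refine ⟨T, ?_⟩
    have := (ENNReal.ofReal_lt_iff_lt_toReal (by positivity) (by norm_num)).1 hT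
    simpa using this.le
  choose T hT using h2
  let r : ℕ → ℝ := fun n => ‖((T n).symm : (BlockPoint n → 𝕜) →L[𝕜] E (s (m n)))‖
  have hr : ∀ n, 0 < r n := by
    intro n
    have : Nontrivial (E (s (m n))) := (T n).symm.injective.nontrivial
    exact (T n).symm.norm_pos
  have hrn : ∀ n, ‖((r n : ℝ) : 𝕜)‖ = r n := fun n => by
    rw [RCLike.norm_ofReal, abs_of_pos (hr n)]
  have hr0 : ∀ n, ((r n : ℝ) : 𝕜) ≠ 0 := fun n => by
    rw [Ne, RCLike.ofReal_eq_zero]; exact (hr n).ne'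
  -- Dividing the inclusion by the norm of `T.symm` makes it a contraction; the Banach–Mazur
  -- constant 2 then falls on the projection.
  refine ⟨{
    incl := fun n => ((r n : ℝ) : 𝕜)⁻¹ • (D.single (m n)).comp
      ((T n).symm : (BlockPoint n → 𝕜) →L[𝕜] E (s (m n)))
    proj := fun n => ((r n : ℝ) : 𝕜) •
      (T n : E (s (m n)) →L[𝕜] (BlockPoint n → 𝕜)).comp (D.proj (m n))
    norm_incl_le := fun n => ?_
    norm_proj_le := fun n => ?_
    proj_incl := fun n f => ?_
    proj_incl_of_ne := fun i j hij f => ?_ }⟩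
  · rw [norm_smul, norm_inv, hrn, inv_mul_le_iff₀ (hr n), mul_one]
    refine (ContinuousLinearMap.opNorm_comp_le _ _).trans ?_
    exact mul_le_of_le_one_left (norm_nonneg _) (D.norm_single_le _)
  · rw [norm_smul, hrn]
    have h3 := ContinuousLinearMap.opNorm_comp_le
      (T n : E (s (m n)) →L[𝕜] (BlockPoint n → 𝕜)) (D.proj (m n))
    have h4 : ‖(T n : E (s (m n)) →L[𝕜] (BlockPoint n → 𝕜))‖ * ‖D.proj (m n)‖ ≤
        ‖(T n : E (s (m n)) →L[𝕜] (BlockPoint n → 𝕜))‖ :=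
      mul_le_of_le_one_right (norm_nonneg _) (D.norm_proj_le _)
    calc _ ≤ r n * ‖(T n : E (s (m n)) →L[𝕜] (BlockPoint n → 𝕜))‖ :=
          mul_le_mul_of_nonneg_left (h3.trans h4) (hr n).le
      _ ≤ 2 := by rw [mul_comm]; exact hT n
  · change ((r n : ℝ) : 𝕜) • T n (D.proj (m n)
      (((r n : ℝ) : 𝕜)⁻¹ • D.single (m n) ((T n).symm f))) = f
    rw [map_smul, map_smul, smul_inv_smul₀ (hr0 n), D.proj_single_self,
      ContinuousLinearEquiv.apply_symm_apply]
  · change ((r i : ℝ) : 𝕜) • T i (D.proj (m i)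
      (((r j : ℝ) : 𝕜)⁻¹ • D.single (m j) ((T j).symm f))) = 0
    rw [map_smul, D.proj_single_of_ne _ _ (hm.ne hij), smul_zero, map_zero, smul_zero]

end JohnsonSpaces

theorem theorem4p5 {𝕜 : Type u} [RCLike 𝕜] :
    ∃ Γ : Type, Uncountable Γ ∧
      ∀ (E : ℕ → Type v) [∀ n, NormedAddCommGroup (E n)] [∀ n, NormedSpace 𝕜 (E n)]
        [∀ n, FiniteDimensional 𝕜 (E n)],
        IsBanachMazurDense 𝕜 E →
        ∀ s : ℕ → ℕ, (∀ n, {m | s m = n}.Infinite) →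
        ∀ (p : ℝ≥0∞) [Fact (1 ≤ p)],
          IsomorphicallyEmbeds 𝕜 (cZero 𝕜 Γ)
            (CompactByApproximable 𝕜 (FigielJohnsonSpace 𝕜 E s p)) ∧
          ¬ TopologicalSpace.SeparableSpace
            (CompactByApproximable 𝕜 (FigielJohnsonSpace 𝕜 E s p)) := by
  -- The index set is the parameter set of the hyperplanes, independent of the spaces and of p.
  refine ⟨ℝ, inferInstance, fun E _ _ _ hE s hs p _ => ?_⟩
  have hcE : ∀ n, CompleteSpace (E n) := fun n => FiniteDimensional.complete 𝕜 (E n)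
  have hcJ : CompleteSpace (JohnsonSpace 𝕜 E s p) :=
    completeSpace_lpDirectSum (𝕜 := 𝕜) (E := fun m => E (s m)) (p := p)
  let DJ : SumSystem 𝕜 (fun m => E (s m)) (JohnsonSpace 𝕜 E s p) :=
    lpDirectSum.sumSystem 𝕜 (fun m => E (s m)) p
  obtain ⟨B⟩ := DJ.nonempty_blockSystem hE hs
  obtain ⟨a, b, R, ha, hb, hR⟩ := exists_real_family_of_notMem_approximableOperators
    (B.isClosed_space _) (B.isClosed_space _) B.isCompactOperator_diagonalRestrict
    B.diagonalRestrict_notMem_approximableOperators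
  have hcW : ∀ W : ClosedInfDimSubspace 𝕜 (JohnsonSpace 𝕜 E s p), CompleteSpace W.1 :=
    fun W => W.2.1.completeSpace_coe
  have hcZ : CompleteSpace (FigielJohnsonSpace 𝕜 E s p) := completeSpace_lpDirectSum (𝕜 := 𝕜)
    (E := fun W : ClosedInfDimSubspace 𝕜 (JohnsonSpace 𝕜 E s p) => W.1) (p := p)
  let DZ : SumSystem 𝕜 (fun W : ClosedInfDimSubspace 𝕜 (JohnsonSpace 𝕜 E s p) => W.1)
    (FigielJohnsonSpace 𝕜 E s p) := lpDirectSum.sumSystem 𝕜 _ p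
  have hemb := DZ.isomorphicallyEmbeds_compactByApproximable R (cZero.nullSystem 𝕜 ℝ) ha hb hR
  exact ⟨hemb, hemb.not_separableSpace fun _ _ hst =>
    (lpDirectSum.sumSystem 𝕜 (fun _ : ℝ => 𝕜) ∞).one_le_norm_single_sub hst⟩
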